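/- Let $p\in[1,2]$, $\alpha\in(0,1)$, $\gamma>1$, $k_0>0$ and $a_-,a_+,\lambda_-,\lambda_+>0$. Let $(\theta_{1,n})_{n\ge 0}$, $(\theta_{2,n})_{n\ge 0}$ be jointly independent copies of a real tempered stable random variable $\theta$ with characteristic function $$\mathbb E[e^{it\theta}]=\exp\Big(\int_{\mathbb R}\big(e^{itx}-1-i\kappa(x)tx\big)\,\lambda(dx)\Big),\qquad t\in\mathbb R,$$ where $\kappa(x)=\mathbf 1_{\{|x|<1\}}+|x|^{-1}\mathbf 1_{\{|x|\ge 1\}}$ and $$\lambda(dx)=a_-\frac{e^{-\lambda_-|x|}}{|x|^{1+\alpha}}\mathbf 1_{\{x<0\}}\,dx+a_+\frac{e^{-\lambda_+x}}{x^{1+\alpha}}\mathbf 1_{\{x>0\}}\,dx .$$ On the complex Banach space $E=\ell^p(\mathbb N)$ with canonical basis $(e_n)_{n\ge 0}$, let $T$ be the bounded weighted backward shift given by $Te_0=0$ and $Te_{n+1}=\omega_n e_n$ with $\omega_n=\big(\tfrac{n+2}{n+1}\big)^{\gamma/p}$, $n\ge 0$, and let $k_n=k_0\prod_{l=0}^{n-1}\omega_l^{-1}$.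 Then the series $\sum_{n\ge 0}k_n(\theta_{1,n}+i\theta_{2,n})e_n$ converges almost surely in $E$. Let $\mu$ be its distribution, and for $x^*,y^*\in E^*$ let $$C_\mu^=(x^*,y^*)=\log\int_E e^{i\,\mathrm{Re}\langle z,x^*-y^*\rangle}\mu(dz)-\log\int_E e^{i\,\mathrm{Re}\langle z,x^*\rangle}\mu(dz)-\log\int_E e^{-i\,\mathrm{Re}\langle z,y^*\rangle}\mu(dz)$$ be the codifference. Here $\log\int_E e^{iY}d\mu$ denotes the distinguished logarithm, i.e. the value at $t=1$ of the unique continuous $\psi:\mathbb R\to\mathbb C$ with $\psi(0)=0$ and $e^{\psi(t)}=\int_E e^{itY}d\mu$ for all $t$; it exists for all the functions $Y$ above. The operator $T$ admits $\mu$ as an invariant measure and is (strongly) mixing with respect to $\mu$, i.e. $\mu(A\cap T^{-n}B)\to\mu(A)\mu(B)$ for all Borel sets $A,B\subset E$. Moreover, writing $$K=2^{5-p}\big(a_-\lambda_-^{\alpha-p}+a_+\lambda_+^{\alpha-p}\big)\Gamma(p-\alpha)\,k_0^p$$ and $\mathrm B$ for the beta function, for all $n\ge 1$: $$\sup_{x^*,y^*\in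 E^*\setminus\{0\}}\frac{|C_\mu^=(x^*,T^{*n}y^*)|}{\|x^*\|^{p/2}\|y^*\|^{p/2}}\le \begin{cases}K\,\mathrm B\big(1-\tfrac\gamma2,\gamma-1\big)\,n^{-(\gamma-1)}, & 1<\gamma<2,\\[1ex] K\,\mathrm B\big(\tfrac\varepsilon2,1-\varepsilon\big)\,n^{-(1-\varepsilon)}\ \text{ for every }\varepsilon\in(0,1), & \gamma\ge 2.\end{cases}$$ -/

import Mathlib

open MeasureTheory ProbabilityTheory Filter Topology
open scoped ENNReal

/-- The complex sequence space `ℓ^p(ℕ)`. -/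
abbrev EllP (p : ℝ≥0∞) : Type := lp (fun _ : ℕ => ℂ) p

/-- The canonical basis vector `e_n` of `ℓ^p(ℕ)`. -/
noncomputable def basisVec (p : ℝ≥0∞) (n : ℕ) : EllP p := lp.single p n (1 : ℂ)

section Shift

variable {p : ℝ≥0∞} {w : ℕ → ℝ} {C : ℝ}

theorem shiftSeq_sum_le [Fact (1 ≤ p)] (hp : 0 < p.toReal) (hC : 0 ≤ C) (hw : ∀ n, |w n| ≤ C)
    (x : EllP p) (s : Finset ℕ) :
    ∑ n ∈ s, ‖(w n : ℂ) * x (n + 1)‖ ^ p.toReal ≤ (C * ‖x‖) ^ p.toReal := by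
  have h1 : ∀ n ∈ s, ‖(w n : ℂ) * x (n + 1)‖ ^ p.toReal
      ≤ C ^ p.toReal * ‖x (n + 1)‖ ^ p.toReal := by
    intro n _
    rw [← Real.mul_rpow hC (norm_nonneg _)]
    refine Real.rpow_le_rpow (norm_nonneg _) ?_ hp.le
    rw [norm_mul, Complex.norm_real, Real.norm_eq_abs]
    exact mul_le_mul_of_nonneg_right (hw n) (norm_nonneg _)
  refine (Finset.sum_le_sum h1).trans ?_
  rw [← Finset.mul_sum, Real.mul_rpow hC (norm_nonneg _)]
  refine mul_le_mul_of_nonneg_left ?_ (Real.rpow_nonneg hC _)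
  have h2 := lp.sum_rpow_le_norm_rpow hp x (s.map (addRightEmbedding 1))
  simpa using h2

theorem shiftSeq_norm_le [Fact (1 ≤ p)] (hC : 0 ≤ C) (hw : ∀ n, |w n| ≤ C) (x : EllP p) (n : ℕ) :
    ‖(w n : ℂ) * x (n + 1)‖ ≤ C * ‖x‖ := by
  have hp : p ≠ 0 := (lt_of_lt_of_le one_pos (Fact.out : 1 ≤ p)).ne'
  rw [norm_mul, Complex.norm_real, Real.norm_eq_abs]
  exact mul_le_mul (hw n) (lp.norm_apply_le_norm hp x _) (norm_nonneg _) hC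

theorem shiftSeq_memLp [Fact (1 ≤ p)] (hC : 0 ≤ C) (hw : ∀ n, |w n| ≤ C) (x : EllP p) :
    Memℓp (fun n => (w n : ℂ) * x (n + 1)) p := by
  rcases p.trichotomy with h | h | h
  · exact absurd h (lt_of_lt_of_le one_pos (Fact.out : 1 ≤ p)).ne'
  · subst h
    refine memℓp_infty ⟨C * ‖x‖, ?_⟩
    rintro _ ⟨n, rfl⟩
    exact shiftSeq_norm_le hC hw x n
  · exact memℓp_gen' (shiftSeq_sum_le h hC hw x)

/-- The bounded weighted backward shift `(Tx)_n = w_n x_{n+1}` on `ℓ^p(ℕ)`. -/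
noncomputable def weightedBackwardShift (p : ℝ≥0∞) [Fact (1 ≤ p)] (w : ℕ → ℝ) (C : ℝ)
    (hC : 0 ≤ C) (hw : ∀ n, |w n| ≤ C) : EllP p →L[ℂ] EllP p :=
  LinearMap.mkContinuous
    { toFun := fun x => ⟨fun n => (w n : ℂ) * x (n + 1), shiftSeq_memLp hC hw x⟩
      map_add' := fun x y => by
        ext n
        exact mul_add _ _ _
      map_smul' := fun c x => by
        ext n
        simp [mul_left_comm] }
    C (fun x => by
      rcases p.trichotomy with h | h | h
      · exact absurd h (lt_of_lt_of_le one_pos (Fact.out : 1 ≤ p)).ne'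
      · subst h
        exact lp.norm_le_of_forall_le (mul_nonneg hC (norm_nonneg _)) (shiftSeq_norm_le hC hw x)
      · exact lp.norm_le_of_forall_sum_le h (mul_nonneg hC (norm_nonneg _))
          (shiftSeq_sum_le h hC hw x))

theorem weightedBackwardShift_apply [Fact (1 ≤ p)] (hC : 0 ≤ C) (hw : ∀ n, |w n| ≤ C)
    (x : EllP p) (n : ℕ) :
    weightedBackwardShift p w C hC hw x n = (w n : ℂ) * x (n + 1) := rfl

theorem weightedBackwardShift_basisVec_zero [Fact (1 ≤ p)] (hC : 0 ≤ C) (hw : ∀ n, |w n| ≤ C) :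
    weightedBackwardShift p w C hC hw (basisVec p 0) = 0 := by
  ext n
  simp [weightedBackwardShift_apply, basisVec, lp.single_apply]

theorem weightedBackwardShift_basisVec_succ [Fact (1 ≤ p)] (hC : 0 ≤ C) (hw : ∀ n, |w n| ≤ C)
    (n : ℕ) :
    weightedBackwardShift p w C hC hw (basisVec p (n + 1)) = (w n : ℂ) • basisVec p n := by
  ext m
  rw [weightedBackwardShift_apply, lp.coeFn_smul, Pi.smul_apply, smul_eq_mul]
  by_cases h : m = n
  · subst h
    simp [basisVec, lp.single_apply]
  · simp [basisVec, lp.single_apply, h]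

end Shift

/-- The weights `ω_n = ((n+2)/(n+1))^{γ/p}`. -/
noncomputable def shiftWeight (γ p : ℝ) (n : ℕ) : ℝ := (((n : ℝ) + 2) / ((n : ℝ) + 1)) ^ (γ / p)

theorem abs_shiftWeight_le {γ p : ℝ} (hγ : 0 ≤ γ) (hp : 0 ≤ p) (n : ℕ) :
    |shiftWeight γ p n| ≤ 2 ^ (γ / p) := by
  have hn : (0 : ℝ) ≤ n := Nat.cast_nonneg n
  have h0 : (0 : ℝ) ≤ ((n : ℝ) + 2) / ((n : ℝ) + 1) := by positivity
  rw [shiftWeight, abs_of_nonneg (Real.rpow_nonneg h0 _)]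
  refine Real.rpow_le_rpow h0 ?_ (div_nonneg hγ hp)
  rw [div_le_iff₀ (by positivity)]
  linarith

/-- The bounded backward shift on `ℓ^p(ℕ)` with weights `((n+2)/(n+1))^{γ/p}`. -/
noncomputable def powerShift (p : ℝ≥0∞) [Fact (1 ≤ p)] (γ : ℝ) (hγ : 1 < γ) :
    EllP p →L[ℂ] EllP p :=
  weightedBackwardShift p (shiftWeight γ p.toReal) (2 ^ (γ / p.toReal))
    (Real.rpow_nonneg zero_le_two _) (abs_shiftWeight_le (zero_le_one.trans hγ.le) ENNReal.toReal_nonneg)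

/-- The coefficients `k_n = k_0 ∏_{l<n} 1/ω_l`. -/
noncomputable def shiftCoeff (γ p k₀ : ℝ) (n : ℕ) : ℝ :=
  k₀ * ∏ l ∈ Finset.range n, 1 / shiftWeight γ p l

/-- The density of the two-sided tempered stable Lévy measure. -/
noncomputable def temperedDensity (α aₙ aₚ lₙ lₚ x : ℝ) : ℝ :=
  if x < 0 then aₙ * Real.exp (-lₙ * |x|) / |x| ^ (1 + α)
  else if 0 < x then aₚ * Real.exp (-lₚ * x) / x ^ (1 + α)
  else 0

/-- The two-sided tempered stable Lévy measure on `ℝ`. -/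
noncomputable def temperedLevyMeasure (α aₙ aₚ lₙ lₚ : ℝ) : Measure ℝ :=
  volume.withDensity (fun x => ENNReal.ofReal (temperedDensity α aₙ aₚ lₙ lₚ x))

/-- The truncation function `κ(x) = 1` for `|x| < 1` and `1/|x|` for `|x| ≥ 1`. -/
noncomputable def truncation (x : ℝ) : ℝ := if |x| < 1 then 1 else 1 / |x|

/-- `ν` is the driftless two-sided tempered stable law: its characteristic function is
`exp (∫ (e^{itx} - 1 - i κ(x) t x) λ(dx))`. -/
def IsTemperedStable (α aₙ aₚ lₙ lₚ : ℝ) (ν : Measure ℝ) : Prop :=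
  IsProbabilityMeasure ν ∧ ∀ t : ℝ, charFun ν t =
    Complex.exp (∫ x, (Complex.exp (Complex.I * (t * x : ℝ)) - 1
      - Complex.I * (truncation x * t * x : ℝ)) ∂(temperedLevyMeasure α aₙ aₚ lₙ lₚ))

/-- The `n`-th term `k_n (θ_{1,n} + i θ_{2,n}) e_n` of the random series. -/
noncomputable def seriesTerm {Ω : Type*} (p : ℝ≥0∞) (k : ℕ → ℝ) (θ : Fin 2 → ℕ → Ω → ℝ)
    (ω : Ω) (n : ℕ) : EllP p :=
  ((k n : ℂ) * ((θ 0 n ω : ℂ) + Complex.I * (θ 1 n ω : ℂ))) • basisVec p n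

/-- The random series `∑_n k_n (θ_{1,n} + i θ_{2,n}) e_n` (and `0` where it diverges). -/
noncomputable def randomSeries {Ω : Type*} (p : ℝ≥0∞) [Fact (1 ≤ p)] (k : ℕ → ℝ)
    (θ : Fin 2 → ℕ → Ω → ℝ) (ω : Ω) : EllP p :=
  ∑' n, seriesTerm p k θ ω n

/-- Strong mixing of a measure-preserving map:
`μ(A ∩ T^{-n} B) → μ(A) μ(B)` for all measurable `A`, `B`. -/
def IsStronglyMixing {E : Type*} [MeasurableSpace E] (T : E → E) (μ : Measure E) : Prop :=
  MeasurePreserving T μ μ ∧ ∀ A B : Set E, MeasurableSet A → MeasurableSet B →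
    Tendsto (fun n : ℕ => μ (A ∩ (T^[n]) ⁻¹' B)) atTop (𝓝 (μ A * μ B))

/-- `ψ` is the distinguished logarithm of `φ`: the continuous function with `ψ(0) = 0` and
`exp ψ = φ`. For a nonvanishing characteristic function it exists, and for an infinitely divisible
law it is the Lévy-Khintchine exponent. -/
def IsDistinguishedLog (φ ψ : ℝ → ℂ) : Prop :=
  Continuous ψ ∧ ψ 0 = 0 ∧ ∀ t, Complex.exp (ψ t) = φ t

theorem IsDistinguishedLog.unique {φ ψ₁ ψ₂ : ℝ → ℂ} (h₁ : IsDistinguishedLog φ ψ₁)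
    (h₂ : IsDistinguishedLog φ ψ₂) : ψ₁ = ψ₂ := by
  obtain ⟨c₁, z₁, e₁⟩ := h₁
  obtain ⟨c₂, z₂, e₂⟩ := h₂
  have key : ∀ t, ∃ n : ℤ, ψ₁ t = ψ₂ t + n * (2 * Real.pi * Complex.I) := fun t =>
    Complex.exp_eq_exp_iff_exists_int.1 ((e₁ t).trans (e₂ t).symm)
  choose n hn using key
  have hpi : (2 * Real.pi * Complex.I : ℂ) ≠ 0 := Complex.two_pi_I_ne_zero
  have hdiv : ∀ t, (n t : ℂ) = (ψ₁ t - ψ₂ t) / (2 * Real.pi * Complex.I) := by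
    intro t
    rw [hn t]
    field_simp
    ring
  have hcont : Continuous fun t => ((n t : ℤ) : ℝ) := by
    have h : (fun t => ((n t : ℤ) : ℝ))
        = fun t => ((ψ₁ t - ψ₂ t) / (2 * Real.pi * Complex.I)).re := by
      funext t
      rw [← hdiv t]
      simp
    rw [h]
    exact Complex.continuous_re.comp ((c₁.sub c₂).div_const _)
  have hcn : Continuous n := by
    rw [Int.isClosedEmbedding_coe_real.isInducing.continuous_iff]
    exact hcont
  funext t
  have h0 : n 0 = 0 := by
    have := hdiv 0
    rw [z₁, z₂] at this
    simpa using this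
  have ht : n t = n 0 := PreconnectedSpace.constant inferInstance hcn
  rw [hn t, ht, h0]
  simp

open Classical in
/-- The distinguished logarithm of `φ` (and `0` if there is none). -/
noncomputable def distinguishedLog (φ : ℝ → ℂ) : ℝ → ℂ :=
  if h : ∃ ψ, IsDistinguishedLog φ ψ then h.choose else 0

theorem distinguishedLog_eq {φ ψ : ℝ → ℂ} (h : IsDistinguishedLog φ ψ) :
    distinguishedLog φ = ψ := by
  have hex : ∃ ψ, IsDistinguishedLog φ ψ := ⟨ψ, h⟩
  rw [distinguishedLog, dif_pos hex]
  exact hex.choose_spec.unique h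

/-- The characteristic function `t ↦ ∫ e^{i t Y} dμ` of a real function `Y` under `μ`. -/
noncomputable def realCharFun {E : Type*} [MeasurableSpace E] (μ : Measure E) (Y : E → ℝ)
    (t : ℝ) : ℂ :=
  ∫ z, Complex.exp (Complex.I * (t * Y z : ℝ)) ∂μ

/-- `log ∫ e^{i Y} dμ`, with the distinguished logarithm. -/
noncomputable def logIntegralExp {E : Type*} [MeasurableSpace E] (μ : Measure E) (Y : E → ℝ) : ℂ :=
  distinguishedLog (realCharFun μ Y) 1

/-- The codifference functional `C^=_μ(x^*, y^*)`. -/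
noncomputable def codifference {E : Type*} [NormedAddCommGroup E] [NormedSpace ℂ E]
    [MeasurableSpace E] (μ : Measure E) (x y : E →L[ℂ] ℂ) : ℂ :=
  logIntegralExp μ (fun z => ((x - y) z).re)
    - logIntegralExp μ (fun z => (x z).re)
    - logIntegralExp μ (fun z => -(y z).re)

/-! The law `μ` is the image of a product measure on `Fin 2 × ℕ → ℝ` under the random series. The
relation `k (n + 1) * w n = k n` makes the series intertwine the coordinate shift with `T`, so `(T,
μ)` is a factor of a Bernoulli shift and inherits mixing (`isStronglyMixing_coordShift`,
`IsStronglyMixing.of_factor`). Almost sure convergence needs only a finite second moment of `θ`,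
extracted from the characteristic function near zero, together with `k n ^ p = k₀ ^ p * (n + 1) ^
(-γ)`, which is summable.

For the codifference, `α < 1` gives the Lévy measure a finite first moment, so the one-dimensional
exponent `ψ` is Lipschitz. By independence the logarithm of the characteristic function of a real
functional is a convergent sum of values of `ψ`, continuous in `t`, hence the distinguished one
(`isDistinguishedLog_functionalLog`). Coordinate by coordinate, the codifference of `ψ` is the
integral of `(e^{isx} - 1)(e^{-itx} - 1)`, which is at most a `p`-th moment times `|s|^(p/2)
|t|^(p/2)` (`norm_levyExponent_codifference_le`); that moment is a Gamma value.

Since `T ^ n` moves the coefficients of a functional by `n` places, the sum over coordinates is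
controlled by `∑ (j+1)^(-γ/2) (j+1+n)^(-γ/2)`. Comparison with an integral turns this into a beta
function times `n ^ (-(γ - 1))` (`sum_rpow_mul_add_rpow_le`). The integral diverges at zero when `γ
≥ 2`; there `γ` is lowered to `2 - ε`. -/

/-! ### Exponents of Lévy measures with finite first moment -/

/-- The driftless Lévy exponent of `ν` with respect to the truncation function. -/
noncomputable def levyExponent (ν : Measure ℝ) (t : ℝ) : ℂ :=
  ∫ x, (Complex.exp (Complex.I * (t * x : ℝ)) - 1
      - Complex.I * (_root_.truncation x * t * x : ℝ)) ∂ν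

theorem measurable_truncation : Measurable _root_.truncation := by
  unfold _root_.truncation
  refine Measurable.ite (measurableSet_lt (by fun_prop) measurable_const) (by fun_prop) (by fun_prop)

theorem truncation_nonneg (x : ℝ) : 0 ≤ _root_.truncation x := by
  unfold _root_.truncation
  split_ifs <;> positivity

theorem truncation_le_one (x : ℝ) : _root_.truncation x ≤ 1 := by
  unfold _root_.truncation
  split_ifs with h
  · exact le_rfl
  · rw [not_lt] at h
    rw [div_le_one (by linarith)]
    exact h

theorem norm_exp_I_mul_ofReal_sub_one_le_abs (u : ℝ) :
    ‖Complex.exp (Complex.I * (u : ℂ)) - 1‖ ≤ |u| := by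
  simpa using Real.norm_exp_I_mul_ofReal_sub_one_le (x := u)

theorem norm_exp_I_mul_ofReal_sub_one_le_two (u : ℝ) :
    ‖Complex.exp (Complex.I * (u : ℂ)) - 1‖ ≤ 2 := by
  refine (norm_sub_le _ _).trans ?_
  rw [mul_comm, Complex.norm_exp_ofReal_mul_I, norm_one]
  norm_num

/-- Interpolation between the bounds `2` and `|u|`: write `m = m ^ (1 - q) * m ^ q` and use one
bound on each factor. -/
theorem norm_exp_I_mul_ofReal_sub_one_le_rpow {q : ℝ} (hq₀ : 0 ≤ q) (hq₁ : q ≤ 1) (u : ℝ) :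
    ‖Complex.exp (Complex.I * (u : ℂ)) - 1‖ ≤ 2 ^ (1 - q) * |u| ^ q := by
  set m := ‖Complex.exp (Complex.I * (u : ℂ)) - 1‖ with hm
  rcases (norm_nonneg (Complex.exp (Complex.I * (u : ℂ)) - 1)).eq_or_lt with h | h
  · rw [hm, ← h]
    positivity
  · have h1 : m ≤ 2 := norm_exp_I_mul_ofReal_sub_one_le_two u
    have h2 : m ≤ |u| := norm_exp_I_mul_ofReal_sub_one_le_abs u
    have h3 : 0 ≤ 1 - q := sub_nonneg.2 hq₁
    calc m = m ^ (1 - q) * m ^ q := by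
          rw [← Real.rpow_add (show 0 < m from h)]
          simp
      _ ≤ 2 ^ (1 - q) * |u| ^ q := by
          gcongr

section Exponent

variable {ν : Measure ℝ}

theorem aestronglyMeasurable_levyIntegrand (t : ℝ) :
    AEStronglyMeasurable (fun x : ℝ => Complex.exp (Complex.I * (t * x : ℝ)) - 1
      - Complex.I * (_root_.truncation x * t * x : ℝ)) ν := by
  have := measurable_truncation
  exact Measurable.aestronglyMeasurable (by fun_prop)

/-- The exponential and the compensator each contribute `|s - t| * |x|`. With a finite first moment
this makes the exponent Lipschitz. -/
theorem norm_levyIntegrand_sub_le (s t x : ℝ) :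
    ‖(Complex.exp (Complex.I * (s * x : ℝ)) - 1 - Complex.I * (_root_.truncation x * s * x : ℝ))
      - (Complex.exp (Complex.I * (t * x : ℝ)) - 1 - Complex.I * (_root_.truncation x * t * x : ℝ))‖
      ≤ 2 * |s - t| * |x| := by
  have h : (Complex.exp (Complex.I * (s * x : ℝ)) - 1 - Complex.I * (_root_.truncation x * s * x : ℝ))
      - (Complex.exp (Complex.I * (t * x : ℝ)) - 1 - Complex.I * (_root_.truncation x * t * x : ℝ))
      = Complex.exp (Complex.I * (t * x : ℝ)) * (Complex.exp (Complex.I * ((s - t) * x : ℝ)) - 1)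
        - Complex.I * (_root_.truncation x * (s - t) * x : ℝ) := by
    rw [mul_sub, ← Complex.exp_add]
    push_cast
    ring_nf
  rw [h]
  refine (norm_sub_le _ _).trans ?_
  rw [norm_mul, norm_mul, mul_comm Complex.I ((t * x : ℝ) : ℂ), Complex.norm_exp_ofReal_mul_I,
    Complex.norm_I, Complex.norm_real, Real.norm_eq_abs, abs_mul, abs_mul,
    abs_of_nonneg (truncation_nonneg x)]
  have h1 := norm_exp_I_mul_ofReal_sub_one_le_abs ((s - t) * x)
  rw [abs_mul] at h1
  have h2 : _root_.truncation x * |s - t| * |x| ≤ 1 * |s - t| * |x| := by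
    gcongr
    exact truncation_le_one x
  linarith

theorem integrable_levyIntegrand (hν : Integrable (fun x : ℝ => |x|) ν) (t : ℝ) :
    Integrable (fun x : ℝ => Complex.exp (Complex.I * (t * x : ℝ)) - 1
      - Complex.I * (_root_.truncation x * t * x : ℝ)) ν := by
  refine (hν.const_mul (2 * |t|)).mono' (aestronglyMeasurable_levyIntegrand t)
    (Eventually.of_forall fun x => ?_)
  simpa using norm_levyIntegrand_sub_le t 0 x

theorem levyExponent_zero : levyExponent ν 0 = 0 := by
  simp [levyExponent]

theorem norm_levyExponent_sub_le (hν : Integrable (fun x : ℝ => |x|) ν) (s t : ℝ) :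
    ‖levyExponent ν s - levyExponent ν t‖ ≤ (2 * ∫ x, |x| ∂ν) * |s - t| := by
  unfold levyExponent
  rw [← integral_sub (integrable_levyIntegrand hν s) (integrable_levyIntegrand hν t)]
  refine (norm_integral_le_of_norm_le (hν.const_mul (2 * |s - t|))
    (Eventually.of_forall fun x => norm_levyIntegrand_sub_le s t x)).trans ?_
  rw [integral_const_mul]
  exact le_of_eq (by ring)

theorem norm_levyExponent_le (hν : Integrable (fun x : ℝ => |x|) ν) (t : ℝ) :
    ‖levyExponent ν t‖ ≤ (2 * ∫ x, |x| ∂ν) * |t| := by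
  simpa [levyExponent_zero] using norm_levyExponent_sub_le hν t 0

/-- The compensator is purely imaginary, so only `1 - cos (t * x) ≤ (t * x) ^ 2 / 2` is left to
integrate. -/
theorem neg_re_levyExponent_le (hν : Integrable (fun x : ℝ => |x|) ν)
    (hν₂ : Integrable (fun x : ℝ => x ^ 2) ν) (t : ℝ) :
    -(levyExponent ν t).re ≤ (∫ x, x ^ 2 ∂ν) / 2 * t ^ 2 := by
  have h1 := (integrable_levyIntegrand hν t)
  have h2 : (levyExponent ν t).re = ∫ x, (Complex.exp (Complex.I * (t * x : ℝ)) - 1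
      - Complex.I * (_root_.truncation x * t * x : ℝ)).re ∂ν := (integral_re h1).symm
  rw [h2, ← integral_neg]
  calc _ ≤ ∫ x, t ^ 2 / 2 * x ^ 2 ∂ν := by
        refine integral_mono h1.re.neg (hν₂.const_mul _) fun x => ?_
        have h3 := Real.one_sub_sq_div_two_le_cos (x := t * x)
        rw [mul_comm Complex.I, mul_comm Complex.I]
        simp only [Complex.sub_re, Complex.exp_ofReal_mul_I_re, Complex.one_re,
          Complex.re_ofReal_mul, Complex.I_re, mul_zero, sub_zero]
        nlinarith
    _ = _ := by
        rw [integral_const_mul]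
        ring

/-- The codifference of a Lévy exponent at a pair of frequencies. -/
theorem levyExponent_codifference (hν : Integrable (fun x : ℝ => |x|) ν) (s t : ℝ) :
    levyExponent ν (s - t) - levyExponent ν s - levyExponent ν (-t)
      = ∫ x, (Complex.exp (Complex.I * (s * x : ℝ)) - 1)
        * (Complex.exp (Complex.I * (-t * x : ℝ)) - 1) ∂ν := by
  unfold levyExponent
  rw [← integral_sub (integrable_levyIntegrand hν _) (integrable_levyIntegrand hν _)]
  refine (integral_sub ((integrable_levyIntegrand hν _).sub (integrable_levyIntegrand hν _))
    (integrable_levyIntegrand hν _)).symm.trans ?_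
  congr 1
  funext x
  -- The compensators are linear in the frequency and `(s - t) - s - (-t) = 0`, so they cancel; what
  -- remains factors as a product.
  have : Complex.exp (Complex.I * ((s - t) * x : ℝ))
      = Complex.exp (Complex.I * (s * x : ℝ)) * Complex.exp (Complex.I * (-t * x : ℝ)) := by
    rw [← Complex.exp_add]
    push_cast
    ring_nf
  simp only [Pi.sub_apply]
  rw [this]
  push_cast
  ring

/-- Each factor of the product formula is interpolated with exponent `p / 2`, admissible because `p
≤ 2`; the two powers of `|x|` combine to `|x| ^ p`. -/
theorem norm_levyExponent_codifference_le (hν : Integrable (fun x : ℝ => |x|) ν) {p : ℝ}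
    (hp₀ : 0 ≤ p) (hp₂ : p ≤ 2) (hp : Integrable (fun x : ℝ => |x| ^ p) ν) (s t : ℝ) :
    ‖levyExponent ν (s - t) - levyExponent ν s - levyExponent ν (-t)‖
      ≤ 2 ^ (2 - p) * (∫ x, |x| ^ p ∂ν) * (|s| ^ (p / 2) * |t| ^ (p / 2)) := by
  rw [levyExponent_codifference hν]
  refine (norm_integral_le_of_norm_le
    (hp.const_mul (2 ^ (2 - p) * (|s| ^ (p / 2) * |t| ^ (p / 2))))
    (Eventually.of_forall fun x => ?_)).trans ?_
  · rw [norm_mul]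
    have h1 := norm_exp_I_mul_ofReal_sub_one_le_rpow (q := p / 2) (by linarith) (by linarith)
    calc _ ≤ (2 ^ (1 - p / 2) * |s * x| ^ (p / 2)) * (2 ^ (1 - p / 2) * |-t * x| ^ (p / 2)) := by
          gcongr
          · exact h1 _
          · exact h1 _
      _ = (2 ^ (1 - p / 2) * 2 ^ (1 - p / 2)) * (|s| ^ (p / 2) * |t| ^ (p / 2))
            * (|x| ^ (p / 2) * |x| ^ (p / 2)) := by
          rw [abs_mul, abs_mul, abs_neg, Real.mul_rpow (abs_nonneg _) (abs_nonneg _),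
            Real.mul_rpow (abs_nonneg _) (abs_nonneg _)]
          ring
      _ = _ := by
          rw [← Real.rpow_add two_pos, ← Real.rpow_add_of_nonneg (abs_nonneg x) (by linarith)
            (by linarith)]
          ring_nf
  · rw [integral_const_mul]
    exact le_of_eq (by ring)

end Exponent

/-! ### Second moments from characteristic functions -/

/-- The left side is `1 - e^a cos b` with `ψ t = a + ib`. As `e^a ≤ 1`, it is at most `(1 - e^a) +
(1 - cos b) ≤ -a + b ^ 2 / 2`. -/
theorem integral_one_sub_cos_le {ρ : Measure ℝ} [IsProbabilityMeasure ρ] {ψ : ℝ → ℂ} {C L : ℝ}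
    (hψ : ∀ t, charFun ρ t = Complex.exp (ψ t)) (hL : ∀ t, ‖ψ t‖ ≤ L * |t|)
    (hC : ∀ t, -(ψ t).re ≤ C * t ^ 2) (t : ℝ) :
    ∫ x, (1 - Real.cos (t * x)) ∂ρ ≤ (C + L ^ 2 / 2) * t ^ 2 := by
  have hint : Integrable (fun x : ℝ => Complex.exp ((t * x : ℝ) * Complex.I)) ρ := by
    refine (integrable_const (1 : ℝ)).mono' (Measurable.aestronglyMeasurable (by fun_prop))
      (Eventually.of_forall fun x => ?_)
    rw [Complex.norm_exp_ofReal_mul_I]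
  have h1 : ∫ x, Real.cos (t * x) ∂ρ = (charFun ρ t).re := by
    rw [charFun_apply_real]
    simp only [← Complex.ofReal_mul]
    refine Eq.trans ?_ (integral_re hint)
    simp only [RCLike.re_to_complex, Complex.exp_ofReal_mul_I_re]
  have hic : Integrable (fun x : ℝ => Real.cos (t * x)) ρ := by
    refine (integrable_const (1 : ℝ)).mono' (Measurable.aestronglyMeasurable (by fun_prop))
      (Eventually.of_forall fun x => Real.abs_cos_le_one _)
  rw [integral_sub (integrable_const _) hic, h1]
  simp only [integral_const, probReal_univ, one_smul]
  have h2 : (charFun ρ t).re = Real.exp (ψ t).re * Real.cos (ψ t).im := by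
    rw [hψ, Complex.exp_re]
  have h3 : Real.exp (ψ t).re ≤ 1 := by
    rw [← Complex.norm_exp, ← hψ]
    exact norm_charFun_le_one t
  have h4 := Real.add_one_le_exp (ψ t).re
  have h5 := Real.one_sub_sq_div_two_le_cos (x := (ψ t).im)
  have h6 : (ψ t).im ^ 2 ≤ L ^ 2 * t ^ 2 := by
    have := (Complex.abs_im_le_norm (ψ t)).trans (hL t)
    calc (ψ t).im ^ 2 = |(ψ t).im| ^ 2 := (sq_abs _).symm
      _ ≤ (L * |t|) ^ 2 := by gcongr
      _ = _ := by rw [mul_pow, sq_abs]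
  have h7 := hC t
  have h8 := Real.cos_le_one (ψ t).im
  have h9 := Real.exp_pos (ψ t).re
  rw [h2]
  nlinarith

/-- Fatou's lemma: `(1 - cos (t * x)) / t ^ 2` has integral bounded in `t`, and for small `t` it
dominates a multiple of `x ^ 2`. -/
theorem lintegral_sq_lt_top_of_charFun {ρ : Measure ℝ} [IsProbabilityMeasure ρ] {ψ : ℝ → ℂ}
    {C L : ℝ} (hψ : ∀ t, charFun ρ t = Complex.exp (ψ t)) (hL : ∀ t, ‖ψ t‖ ≤ L * |t|)
    (hC : ∀ t, -(ψ t).re ≤ C * t ^ 2) :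
    ∫⁻ x, ENNReal.ofReal (x ^ 2) ∂ρ < ∞ := by
  -- The constant in `cos u ≤ 1 - c * u ^ 2`, valid for `|u| ≤ π`; below, `t = 1 / (n + 1)`.
  set c : ℝ := 2 / Real.pi ^ 2 with hc
  have hc0 : 0 < c := by positivity
  let f : ℕ → ℝ → ℝ≥0∞ := fun n x =>
    ENNReal.ofReal (((n : ℝ) + 1) ^ 2 / c * (1 - Real.cos (((n : ℝ) + 1)⁻¹ * x)))
  have hf : ∀ n, ∫⁻ x, f n x ∂ρ ≤ ENNReal.ofReal ((C + L ^ 2 / 2) / c) := by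
    intro n
    have hic : Integrable (fun x : ℝ => 1 - Real.cos (((n : ℝ) + 1)⁻¹ * x)) ρ := by
      refine (integrable_const (2 : ℝ)).mono' (Measurable.aestronglyMeasurable (by fun_prop))
        (Eventually.of_forall fun x => ?_)
      rw [Real.norm_eq_abs, abs_le]
      constructor <;> linarith [Real.cos_le_one (((n : ℝ) + 1)⁻¹ * x),
        Real.neg_one_le_cos (((n : ℝ) + 1)⁻¹ * x)]
    rw [← ofReal_integral_eq_lintegral_ofReal (hic.const_mul _) (Eventually.of_forall fun x => by
      have := Real.cos_le_one (((n : ℝ) + 1)⁻¹ * x)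
      have : 0 ≤ 1 - Real.cos (((n : ℝ) + 1)⁻¹ * x) := by linarith
      simp only [Pi.zero_apply]
      positivity), integral_const_mul]
    refine ENNReal.ofReal_le_ofReal ?_
    have := integral_one_sub_cos_le hψ hL hC ((n : ℝ) + 1)⁻¹
    calc _ ≤ ((n : ℝ) + 1) ^ 2 / c * ((C + L ^ 2 / 2) * ((n : ℝ) + 1)⁻¹ ^ 2) := by gcongr
      _ = _ := by field_simp
  have hlim : ∀ x : ℝ, ENNReal.ofReal (x ^ 2) ≤ liminf (fun n => f n x) atTop := by
    intro x
    refine le_liminf_of_le (by isBoundedDefault) ?_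
    obtain ⟨N, hN⟩ := exists_nat_ge |x|
    filter_upwards [eventually_ge_atTop N] with n hn
    refine ENNReal.ofReal_le_ofReal ?_
    have hn' : (N : ℝ) ≤ n := by exact_mod_cast hn
    have hx : |((n : ℝ) + 1)⁻¹ * x| ≤ Real.pi := by
      rw [abs_mul, abs_of_pos (by positivity), inv_mul_le_iff₀ (by positivity)]
      nlinarith [Real.pi_gt_three]
    have h2 := Real.cos_le_one_sub_mul_cos_sq hx
    calc x ^ 2 = ((n : ℝ) + 1) ^ 2 / c * (c * (((n : ℝ) + 1)⁻¹ * x) ^ 2) := by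
          field_simp
      _ ≤ _ := by
          gcongr
          linarith
  calc _ ≤ ∫⁻ x, liminf (fun n => f n x) atTop ∂ρ := lintegral_mono hlim
    _ ≤ liminf (fun n => ∫⁻ x, f n x ∂ρ) atTop := lintegral_liminf_le fun n => by fun_prop
    _ ≤ ENNReal.ofReal ((C + L ^ 2 / 2) / c) := by
        refine liminf_le_of_le (by isBoundedDefault) fun b hb => ?_
        obtain ⟨n, hn⟩ := hb.exists
        exact hn.trans (hf n)
    _ < ∞ := ENNReal.ofReal_lt_top

/-! ### Moments of the tempered stable Lévy measure -/

section TemperedMoments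

variable {α aₙ aₚ lₙ lₚ : ℝ}

theorem measurable_temperedDensity : Measurable (temperedDensity α aₙ aₚ lₙ lₚ) := by
  unfold temperedDensity
  exact Measurable.ite measurableSet_Iio (by fun_prop)
    (Measurable.ite measurableSet_Ioi (by fun_prop) measurable_const)

theorem temperedDensity_nonneg (haₙ : 0 ≤ aₙ) (haₚ : 0 ≤ aₚ) (x : ℝ) :
    0 ≤ temperedDensity α aₙ aₚ lₙ lₚ x := by
  unfold temperedDensity
  split_ifs <;> positivity

theorem temperedDensity_mul_of_pos {x : ℝ} (hx : 0 < x) (q : ℝ) :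
    temperedDensity α aₙ aₚ lₙ lₚ x * |x| ^ q
      = aₚ * (x ^ (q - α - 1) * Real.exp (-(lₚ * x))) := by
  rw [temperedDensity, if_neg hx.not_gt, if_pos hx, abs_of_pos hx,
    show q - α - 1 = q - (1 + α) by ring, Real.rpow_sub hx, neg_mul]
  ring

theorem temperedDensity_mul_of_neg {x : ℝ} (hx : x < 0) (q : ℝ) :
    temperedDensity α aₙ aₚ lₙ lₚ x * |x| ^ q
      = aₙ * ((-x) ^ (q - α - 1) * Real.exp (-(lₙ * -x))) := by
  rw [temperedDensity, if_pos hx, abs_of_neg hx,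
    show q - α - 1 = q - (1 + α) by ring, Real.rpow_sub (neg_pos.2 hx), neg_mul]
  ring

theorem integrableOn_rpow_mul_exp_neg_mul {a r : ℝ} (ha : 0 < a) (hr : 0 < r) :
    IntegrableOn (fun t : ℝ => t ^ (a - 1) * Real.exp (-(r * t))) (Set.Ioi 0) := by
  -- A non-integrable function has Bochner integral `0`, so the positive Gamma value already proves
  -- integrability.
  refine Integrable.of_integral_ne_zero ?_
  rw [Real.integral_rpow_mul_exp_neg_mul_Ioi ha hr]
  have := Real.Gamma_pos_of_pos ha
  positivity

theorem integrableOn_temperedDensity_mul_Ioi (hlₚ : 0 < lₚ) {q : ℝ} (hq : α < q) :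
    IntegrableOn (fun x => temperedDensity α aₙ aₚ lₙ lₚ x * |x| ^ q) (Set.Ioi 0) :=
  IntegrableOn.congr_fun ((integrableOn_rpow_mul_exp_neg_mul (sub_pos.2 hq) hlₚ).const_mul aₚ)
    (fun _ hx => (temperedDensity_mul_of_pos hx q).symm) measurableSet_Ioi

theorem integrableOn_temperedDensity_mul_Iic (hlₙ : 0 < lₙ) {q : ℝ} (hq : α < q) :
    IntegrableOn (fun x => temperedDensity α aₙ aₚ lₙ lₚ x * |x| ^ q) (Set.Iic 0) := by
  rw [integrableOn_Iic_iff_integrableOn_Iio]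
  have h : IntegrableOn (fun x : ℝ => aₙ * (x ^ (q - α - 1) * Real.exp (-(lₙ * x)))) (Set.Ioi 0) :=
    (integrableOn_rpow_mul_exp_neg_mul (sub_pos.2 hq) hlₙ).const_mul aₙ
  rw [← neg_zero] at h
  exact (h.comp_neg_Iio (c := 0)).congr_fun
    (fun _ hx => (temperedDensity_mul_of_neg hx q).symm) measurableSet_Iio

theorem setIntegral_temperedDensity_mul_Ioi (hlₚ : 0 < lₚ) {q : ℝ} (hq : α < q) :
    ∫ x in Set.Ioi 0, temperedDensity α aₙ aₚ lₙ lₚ x * |x| ^ q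
      = aₚ * lₚ ^ (α - q) * Real.Gamma (q - α) := by
  rw [setIntegral_congr_fun measurableSet_Ioi fun _ hx => temperedDensity_mul_of_pos hx q,
    integral_const_mul, Real.integral_rpow_mul_exp_neg_mul_Ioi (sub_pos.2 hq) hlₚ, one_div,
    ← Real.rpow_neg_eq_inv_rpow, neg_sub, mul_assoc]

theorem setIntegral_temperedDensity_mul_Iic (hlₙ : 0 < lₙ) {q : ℝ} (hq : α < q) :
    ∫ x in Set.Iic 0, temperedDensity α aₙ aₚ lₙ lₚ x * |x| ^ q
      = aₙ * lₙ ^ (α - q) * Real.Gamma (q - α) := by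
  rw [integral_Iic_eq_integral_Iio,
    setIntegral_congr_fun measurableSet_Iio fun _ hx => temperedDensity_mul_of_neg hx q,
    ← integral_Iic_eq_integral_Iio,
    integral_comp_neg_Iic 0 fun x => aₙ * (x ^ (q - α - 1) * Real.exp (-(lₙ * x))),
    integral_const_mul, neg_zero, Real.integral_rpow_mul_exp_neg_mul_Ioi (sub_pos.2 hq) hlₙ,
    one_div, ← Real.rpow_neg_eq_inv_rpow, neg_sub, mul_assoc]

theorem integrable_temperedDensity_mul (hlₙ : 0 < lₙ) (hlₚ : 0 < lₚ) {q : ℝ} (hq : α < q) :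
    Integrable (fun x => temperedDensity α aₙ aₚ lₙ lₚ x * |x| ^ q) := by
  rw [← integrableOn_univ, ← Set.Iic_union_Ioi (a := (0 : ℝ))]
  exact (integrableOn_temperedDensity_mul_Iic hlₙ hq).union
    (integrableOn_temperedDensity_mul_Ioi hlₚ hq)

theorem integrable_abs_rpow_temperedLevyMeasure (haₙ : 0 ≤ aₙ) (haₚ : 0 ≤ aₚ) (hlₙ : 0 < lₙ)
    (hlₚ : 0 < lₚ) {q : ℝ} (hq : α < q) :
    Integrable (fun x : ℝ => |x| ^ q) (temperedLevyMeasure α aₙ aₚ lₙ lₚ) := by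
  rw [temperedLevyMeasure, integrable_withDensity_iff_integrable_smul'
    measurable_temperedDensity.ennreal_ofReal (Eventually.of_forall fun _ => ENNReal.ofReal_lt_top)]
  simp only [ENNReal.toReal_ofReal (temperedDensity_nonneg haₙ haₚ _), smul_eq_mul]
  exact integrable_temperedDensity_mul hlₙ hlₚ hq

theorem integral_abs_rpow_temperedLevyMeasure (haₙ : 0 ≤ aₙ) (haₚ : 0 ≤ aₚ) (hlₙ : 0 < lₙ)
    (hlₚ : 0 < lₚ) {q : ℝ} (hq : α < q) :
    ∫ x, |x| ^ q ∂(temperedLevyMeasure α aₙ aₚ lₙ lₚ)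
      = (aₙ * lₙ ^ (α - q) + aₚ * lₚ ^ (α - q)) * Real.Gamma (q - α) := by
  rw [temperedLevyMeasure, integral_withDensity_eq_integral_toReal_smul
    measurable_temperedDensity.ennreal_ofReal (Eventually.of_forall fun _ => ENNReal.ofReal_lt_top)]
  simp only [ENNReal.toReal_ofReal (temperedDensity_nonneg haₙ haₚ _), smul_eq_mul]
  rw [← intervalIntegral.integral_Iic_add_Ioi (b := 0)
    (integrableOn_temperedDensity_mul_Iic hlₙ hq) (integrableOn_temperedDensity_mul_Ioi hlₚ hq),
    setIntegral_temperedDensity_mul_Iic hlₙ hq, setIntegral_temperedDensity_mul_Ioi hlₚ hq]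
  ring

end TemperedMoments

theorem IsTemperedStable.lintegral_sq_lt_top {α aₙ aₚ lₙ lₚ : ℝ} {ρ : Measure ℝ}
    (hρ : IsTemperedStable α aₙ aₚ lₙ lₚ ρ) (hα₁ : α < 1) (haₙ : 0 ≤ aₙ) (haₚ : 0 ≤ aₚ)
    (hlₙ : 0 < lₙ) (hlₚ : 0 < lₚ) :
    ∫⁻ x, ENNReal.ofReal (x ^ 2) ∂ρ < ∞ := by
  have := hρ.1
  have h1 := integrable_abs_rpow_temperedLevyMeasure haₙ haₚ hlₙ hlₚ hα₁
  have h2 := integrable_abs_rpow_temperedLevyMeasure haₙ haₚ hlₙ hlₚ (hα₁.trans one_lt_two)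
  simp only [Real.rpow_one] at h1
  simp only [Real.rpow_two, sq_abs] at h2
  exact lintegral_sq_lt_top_of_charFun
    (ψ := levyExponent (temperedLevyMeasure α aₙ aₚ lₙ lₚ)) hρ.2
    (norm_levyExponent_le h1) (neg_re_levyExponent_le h1 h2)

/-! ### A beta bound for correlated power sums -/

/-- This is the normalisation of the beta density, multiplied through by `beta a b`. -/
theorem lintegral_Ioo_rpow_mul_rpow {a b : ℝ} (ha : 0 < a) (hb : 0 < b) :
    ∫⁻ x in Set.Ioo (0 : ℝ) 1, ENNReal.ofReal (x ^ (a - 1) * (1 - x) ^ (b - 1))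
      = ENNReal.ofReal (beta a b) := by
  have hB := beta_pos ha hb
  have h := lintegral_betaPDF (α := a) (β := b)
  rw [lintegral_betaPDF_eq_one ha hb] at h
  have h1 : ∀ x : ℝ, ENNReal.ofReal (1 / beta a b * x ^ (a - 1) * (1 - x) ^ (b - 1))
      = ENNReal.ofReal (1 / beta a b) * ENNReal.ofReal (x ^ (a - 1) * (1 - x) ^ (b - 1)) := by
    intro x
    rw [← ENNReal.ofReal_mul (by positivity), mul_assoc]
  simp only [h1] at h
  rw [lintegral_const_mul _ (by fun_prop)] at h
  have h2 := congrArg (fun c => ENNReal.ofReal (beta a b) * c) h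
  simp only [mul_one] at h2
  rw [h2, ← mul_assoc, ← ENNReal.ofReal_mul hB.le, mul_one_div_cancel hB.ne', ENNReal.ofReal_one,
    one_mul]

/-- The substitution `x = u / (u + c)` turns the integrand into `c ^ (-b)` times the beta integrand.
-/
theorem lintegral_Ioi_rpow_mul_add_rpow_le {a b c : ℝ} (ha : 0 < a) (hb : 0 < b) (hc : 0 < c) :
    ∫⁻ u in Set.Ioi (0 : ℝ), ENNReal.ofReal (u ^ (a - 1) * (u + c) ^ (-(a + b)))
      ≤ ENNReal.ofReal (c ^ (-b) * beta a b) := by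
  have hderiv : ∀ u ∈ Set.Ioi (0 : ℝ),
      HasDerivWithinAt (fun u : ℝ => u / (u + c)) (c / (u + c) ^ 2) (Set.Ioi 0) u := by
    intro u hu
    have hu : 0 < u := hu
    have h := (hasDerivAt_id u).div ((hasDerivAt_id u).add_const c)
      (by simp only [id]; positivity)
    refine (h.congr_deriv ?_).hasDerivWithinAt
    simp
  have hinj : Set.InjOn (fun u : ℝ => u / (u + c)) (Set.Ioi 0) := by
    intro u hu v hv h
    have hu : 0 < u := hu
    have hv : 0 < v := hv
    simp only at h
    rw [div_eq_div_iff (by positivity) (by positivity)] at h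
    nlinarith
  -- Inclusion of the image in `(0, 1)` is enough for an upper bound; surjectivity is not needed.
  have himage : (fun u : ℝ => u / (u + c)) '' Set.Ioi 0 ⊆ Set.Ioo 0 1 := by
    rintro _ ⟨u, hu, rfl⟩
    have hu : 0 < u := hu
    refine ⟨by positivity, ?_⟩
    rw [div_lt_one (by positivity)]
    linarith
  have h := lintegral_image_eq_lintegral_abs_deriv_mul measurableSet_Ioi hderiv hinj
    fun x => ENNReal.ofReal (x ^ (a - 1) * (1 - x) ^ (b - 1))
  have h1 : ∀ u ∈ Set.Ioi (0 : ℝ), ENNReal.ofReal (u ^ (a - 1) * (u + c) ^ (-(a + b)))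
      = ENNReal.ofReal (c ^ (-b)) * (ENNReal.ofReal |c / (u + c) ^ 2|
        * ENNReal.ofReal ((u / (u + c)) ^ (a - 1) * (1 - u / (u + c)) ^ (b - 1))) := by
    intro u hu
    have hu : 0 < u := hu
    have huc : 0 < u + c := by positivity
    rw [← ENNReal.ofReal_mul (abs_nonneg _), ← ENNReal.ofReal_mul (by positivity)]
    congr 1
    rw [abs_of_pos (by positivity), show 1 - u / (u + c) = c / (u + c) by field_simp; ring,
      Real.div_rpow hu.le huc.le, Real.div_rpow hc.le huc.le, Real.rpow_neg hc.le,
      Real.rpow_neg huc.le, Real.rpow_sub_one hc.ne', Real.rpow_sub_one huc.ne',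
      Real.rpow_sub_one huc.ne', Real.rpow_add huc]
    have := Real.rpow_pos_of_pos hc b
    field_simp
  rw [setLIntegral_congr_fun measurableSet_Ioi h1, lintegral_const_mul' _ _ ENNReal.ofReal_ne_top,
    ← h, ENNReal.ofReal_mul (by positivity), ← lintegral_Ioo_rpow_mul_rpow ha hb]
  gcongr

/-- For `1 < γ < 2` the correlated power sums `∑ (j+1)^{-γ/2} (j+1+n)^{-γ/2}` converge and are
bounded by `n^{-(γ-1)} B(1-γ/2, γ-1)`. -/
theorem sum_rpow_mul_add_rpow_le {γ : ℝ} (hγ₁ : 1 < γ) (hγ₂ : γ < 2) {n : ℕ} (hn : 1 ≤ n) (N : ℕ) :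
    ∑ j ∈ Finset.range N, ((j : ℝ) + 1) ^ (-(γ / 2)) * ((j : ℝ) + 1 + n) ^ (-(γ / 2))
      ≤ beta (1 - γ / 2) (γ - 1) * (n : ℝ) ^ (-(γ - 1)) := by
  have ha : 0 < 1 - γ / 2 := by linarith
  have hb : 0 < γ - 1 := by linarith
  have hn0 : (0 : ℝ) < n := by exact_mod_cast hn
  let f : ℝ → ℝ≥0∞ := fun u => ENNReal.ofReal (u ^ (-(γ / 2)) * (u + n) ^ (-(γ / 2)))
  -- The integrand is decreasing, so its value at the right endpoint `j + 1` is at most its integral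
  -- over `(j, j + 1]`.
  have h1 : ∀ j : ℕ, ENNReal.ofReal (((j : ℝ) + 1) ^ (-(γ / 2)) * ((j : ℝ) + 1 + n) ^ (-(γ / 2)))
      ≤ ∫⁻ u in Set.Ioc (j : ℝ) (j + 1), f u := by
    intro j
    calc _ = ∫⁻ _ in Set.Ioc (j : ℝ) (j + 1),
          ENNReal.ofReal (((j : ℝ) + 1) ^ (-(γ / 2)) * ((j : ℝ) + 1 + n) ^ (-(γ / 2))) := by
          rw [setLIntegral_const, Real.volume_Ioc]
          simp
      _ ≤ _ := by
          refine setLIntegral_mono' measurableSet_Ioc fun u hu => ENNReal.ofReal_le_ofReal ?_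
          have hu0 : 0 < u := lt_of_le_of_lt (Nat.cast_nonneg j) hu.1
          have h2 : ∀ {x y : ℝ}, 0 < x → x ≤ y → y ^ (-(γ / 2)) ≤ x ^ (-(γ / 2)) := fun hx hxy =>
            Real.rpow_le_rpow_of_nonpos hx hxy (by linarith)
          refine mul_le_mul (h2 hu0 hu.2) (h2 (by positivity) (by linarith [hu.2])) (by positivity)
            (by positivity)
  have hdisj : Set.PairwiseDisjoint (↑(Finset.range N)) fun j : ℕ => Set.Ioc (j : ℝ) (j + 1) := by
    intro i _ j _ hij
    simpa [Function.onFun] using Set.pairwise_disjoint_Ioc_intCast ℝ (Nat.cast_injective.ne hij)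
  have h2 : ENNReal.ofReal (∑ j ∈ Finset.range N,
        ((j : ℝ) + 1) ^ (-(γ / 2)) * ((j : ℝ) + 1 + n) ^ (-(γ / 2)))
      ≤ ENNReal.ofReal (beta (1 - γ / 2) (γ - 1) * (n : ℝ) ^ (-(γ - 1))) := by
    rw [ENNReal.ofReal_sum_of_nonneg fun j _ => by positivity]
    calc _ ≤ ∑ j ∈ Finset.range N, ∫⁻ u in Set.Ioc (j : ℝ) (j + 1), f u :=
          Finset.sum_le_sum fun j _ => h1 j
      _ = ∫⁻ u in ⋃ j ∈ Finset.range N, Set.Ioc (j : ℝ) (j + 1), f u :=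
          (lintegral_biUnion_finset hdisj (fun _ _ => measurableSet_Ioc) _).symm
      _ ≤ ∫⁻ u in Set.Ioi (0 : ℝ), f u := by
          refine lintegral_mono_set ?_
          simp only [Set.iUnion_subset_iff]
          exact fun j _ u hu => lt_of_le_of_lt (Nat.cast_nonneg j) hu.1
      _ ≤ _ := by
          -- Here `a = 1 - γ / 2` and `b = γ - 1`, so both `a - 1` and `-(a + b)` equal `-(γ / 2)`.
          have := lintegral_Ioi_rpow_mul_add_rpow_le ha hb hn0
          rw [show 1 - γ / 2 - 1 = -(γ / 2) by ring,
            show -(1 - γ / 2 + (γ - 1)) = -(γ / 2) by ring] at this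
          rw [mul_comm (beta _ _)]
          exact this
  have hB := beta_pos ha hb
  exact (ENNReal.ofReal_le_ofReal_iff (by positivity)).1 h2

/-! ### Bernoulli shifts and their factors -/

/-- The coordinate shift on families indexed by `J × ℕ`. -/
def coordShift {J S : Type*} (z : J × ℕ → S) : J × ℕ → S := fun i => z (i.1, i.2 + 1)

theorem coordShift_iterate {J S : Type*} (n : ℕ) (z : J × ℕ → S) :
    coordShift^[n] z = fun i => z (i.1, i.2 + n) := by
  induction n generalizing z with
  | zero => rfl
  | succ n ih =>
    rw [Function.iterate_succ_apply, ih]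
    funext i
    simp only [coordShift]
    congr 2

section Bernoulli

variable {J S : Type*} [MeasurableSpace S] {ρ : Measure S} [IsProbabilityMeasure ρ]

theorem measurePreserving_coordShift :
    MeasurePreserving (coordShift (J := J) (S := S)) (Measure.infinitePi fun _ => ρ)
      (Measure.infinitePi fun _ => ρ) := by
  refine ⟨by unfold coordShift; fun_prop, ?_⟩
  have hinj : Function.Injective fun i : J × ℕ => (i.1, i.2 + 1) := by
    rintro ⟨a, b⟩ ⟨c, d⟩ h
    simpa using h
  exact Measure.map_infinitePi_infinitePi_of_inj (P := fun _ : J × ℕ => ρ) hinj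

/-- The cylinder reads only times below `n` and the preimage only times from `n` on, so the events
are independent: for cylinders, mixing is an exact equality at finite time. -/
theorem measure_cylinder_inter_coordShift_preimage {s : Finset (J × ℕ)} {A : Set (s → S)}
    (hA : MeasurableSet A) {B : Set (J × ℕ → S)} (hB : MeasurableSet B) {n : ℕ}
    (hn : ∀ i ∈ s, i.2 < n) :
    (Measure.infinitePi fun _ : J × ℕ => ρ) (cylinder s A ∩ coordShift^[n] ⁻¹' B)
      = (Measure.infinitePi fun _ => ρ) (cylinder s A) * (Measure.infinitePi fun _ => ρ) B := by
  let m : J × ℕ → MeasurableSpace (J × ℕ → S) := fun i =>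
    MeasurableSpace.comap (fun z => z i) inferInstance
  have hm : ∀ i, m i ≤ MeasurableSpace.pi := fun i => (measurable_pi_apply i).comap_le
  have hind : iIndep m (Measure.infinitePi fun _ : J × ℕ => ρ) :=
    iIndepFun_infinitePi (P := fun _ : J × ℕ => ρ) (X := fun _ x => x) fun _ => measurable_id
  have hdisj : Disjoint (↑s : Set (J × ℕ)) {i | n ≤ i.2} := by
    rw [Set.disjoint_left]
    exact fun i hi hi' => absurd (hn i hi) (not_lt.2 hi')
  have h := indep_iSup_of_disjoint hm hind hdisj
  have h1 : Measurable[⨆ i ∈ (↑s : Set (J × ℕ)), m i] (s.restrict : (J × ℕ → S) → s → S) := by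
    refine @measurable_pi_lambda _ _ _ (_) _ _ fun i => ?_
    exact (comap_measurable (fun z : J × ℕ → S => z i)).mono
      (le_iSup₂_of_le (i : J × ℕ) i.2 le_rfl) le_rfl
  have h2 : Measurable[⨆ i ∈ {i : J × ℕ | n ≤ i.2}, m i] (coordShift (J := J) (S := S))^[n] := by
    refine @measurable_pi_lambda _ _ _ (_) _ _ fun i => ?_
    simp only [coordShift_iterate]
    exact (comap_measurable (fun z : J × ℕ → S => z (i.1, i.2 + n))).mono
      (le_iSup₂_of_le (i.1, i.2 + n) (Nat.le_add_left _ _) le_rfl) le_rfl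
  rw [cylinder, (Indep_iff _ _ _).1 h _ _ (h1 hA) (h2 hB),
    (measurePreserving_coordShift.iterate n).measure_preimage hB.nullMeasurableSet]

theorem isStronglyMixing_coordShift :
    IsStronglyMixing (coordShift (J := J) (S := S)) (Measure.infinitePi fun _ => ρ) := by
  refine ⟨measurePreserving_coordShift, fun A B hA hB => ?_⟩
  set Q := Measure.infinitePi fun _ : J × ℕ => ρ
  have hσ : ∀ n, MeasurePreserving (coordShift (J := J) (S := S))^[n] Q Q :=
    measurePreserving_coordShift.iterate
  have hpre : ∀ n, Q (coordShift^[n] ⁻¹' B) = Q B := fun n =>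
    (hσ n).measure_preimage hB.nullMeasurableSet
  have hBm : ∀ n, MeasurableSet ((coordShift (J := J) (S := S))^[n] ⁻¹' B) := fun n =>
    (hσ n).measurable hB
  -- With `B` fixed, the sets `A` that satisfy the limit form a Dynkin class containing the
  -- cylinders.
  induction A, hA using MeasurableSpace.induction_on_inter
    (generateFrom_measurableCylinders (α := fun _ : J × ℕ => S)).symm
    (isPiSystem_measurableCylinders) with
  | empty => simp
  | basic A hA =>
    obtain ⟨s, C, hC, rfl⟩ := (mem_measurableCylinders _).1 hA
    refine tendsto_const_nhds.congr' ?_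
    filter_upwards [eventually_gt_atTop (s.sup fun i => i.2)] with n hn
    exact (measure_cylinder_inter_coordShift_preimage hC hB
      fun i hi => (Finset.le_sup (f := fun i : J × ℕ => i.2) hi).trans_lt hn).symm
  | compl A hA ih =>
    have h1 : ∀ n, Q (Aᶜ ∩ coordShift^[n] ⁻¹' B)
        = Q B - Q (A ∩ coordShift^[n] ⁻¹' B) := by
      intro n
      refine ENNReal.eq_sub_of_add_eq (measure_ne_top _ _) ?_
      rw [← hpre n, Set.inter_comm, Set.inter_comm A, ← Set.sdiff_eq, add_comm,
        measure_inter_add_sdiff _ hA]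
    simp only [h1]
    rw [prob_compl_eq_one_sub hA, ENNReal.sub_mul fun _ _ => measure_ne_top _ _, one_mul]
    exact ENNReal.Tendsto.sub tendsto_const_nhds ih (Or.inl (measure_ne_top _ _))
  | iUnion f hd hf ih =>
    have h1 : ∀ n, Q ((⋃ i, f i) ∩ coordShift^[n] ⁻¹' B)
        = ∑' i, Q (f i ∩ coordShift^[n] ⁻¹' B) := by
      intro n
      rw [Set.iUnion_inter, measure_iUnion (fun i j hij => (hd hij).mono Set.inter_subset_left
        Set.inter_subset_left) fun i => (hf i).inter (hBm n)]
    simp only [h1]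
    rw [measure_iUnion hd hf, ← ENNReal.tsum_mul_right]
    have hfin : ∑' i, Q (f i) ≠ ∞ := by
      rw [← measure_iUnion hd hf]
      exact measure_ne_top _ _
    -- The sum over `i` is read as an integral for counting measure; dominated convergence with the
    -- summable bound `Q (f i)` exchanges it with the limit.
    rw [← lintegral_count] at hfin
    simp only [← lintegral_count]
    exact tendsto_lintegral_of_dominated_convergence (fun i => Q (f i))
      (fun _ => measurable_of_countable _)
      (fun n => Eventually.of_forall fun i => measure_mono Set.inter_subset_left) hfin
      (Eventually.of_forall ih)

end Bernoulli

/-- Factors of strongly mixing systems are strongly mixing. -/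
theorem IsStronglyMixing.of_factor {Z E : Type*} [MeasurableSpace Z] [MeasurableSpace E]
    {σ : Z → Z} {Q : Measure Z} {T : E → E} {G : Z → E} (hσ : IsStronglyMixing σ Q)
    (hT : Measurable T) (hG : AEMeasurable G Q)
    (h : ∀ᵐ z ∂Q, ∀ n : ℕ, T^[n] (G z) = G (σ^[n] z)) : IsStronglyMixing T (Q.map G) := by
  -- `G` is only almost everywhere measurable. As `σ^[n]` preserves `Q`, replacing `G` by a
  -- measurable version is harmless along the whole orbit.
  have hGσ : ∀ n : ℕ, (fun z => G (σ^[n] z)) =ᵐ[Q] fun z => hG.mk G (σ^[n] z) := fun n =>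
    (hσ.1.iterate n).quasiMeasurePreserving.ae_eq_comp hG.ae_eq_mk
  have hTn : ∀ n : ℕ, Measurable T^[n] := hT.iterate
  have hmap : Q.map G = Q.map (hG.mk G) := Measure.map_congr hG.ae_eq_mk
  have hm := hG.measurable_mk
  refine ⟨⟨hT, ?_⟩, fun A B hA hB => ?_⟩
  · calc (Q.map G).map T = Q.map (T ∘ hG.mk G) := by rw [hmap, Measure.map_map hT hm]
      _ = Q.map (hG.mk G ∘ σ) := by
          refine Measure.map_congr ?_
          filter_upwards [h, hGσ 1, hG.ae_eq_mk] with z h1 h2 h3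
          have h4 := h1 1
          simp only [Function.iterate_one] at h2 h4
          simp only [Function.comp_apply, ← h3, h4, h2]
      _ = Q.map G := by rw [← Measure.map_map hm hσ.1.measurable, hσ.1.map_eq, hmap]
  · have h1 : ∀ n : ℕ, (Q.map G) (A ∩ T^[n] ⁻¹' B)
        = Q (hG.mk G ⁻¹' A ∩ σ^[n] ⁻¹' (hG.mk G ⁻¹' B)) := by
      intro n
      rw [hmap, Measure.map_apply hm (hA.inter (hTn n hB))]
      refine measure_congr ?_
      filter_upwards [h, hGσ n, hG.ae_eq_mk] with z h1 h2 h3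
      refine propext ?_
      change (hG.mk G z ∈ A ∧ T^[n] (hG.mk G z) ∈ B) ↔ (hG.mk G z ∈ A ∧ hG.mk G (σ^[n] z) ∈ B)
      rw [← h2, ← h1 n, h3]
    simp only [h1]
    rw [hmap, Measure.map_apply hm hA, Measure.map_apply hm hB]
    exact hσ.2 _ _ (hm hA) (hm hB)

/-! ### The weights and coefficients of the shift -/

section Coefficients

variable {γ p k₀ : ℝ}

theorem shiftWeight_pos (n : ℕ) : 0 < shiftWeight γ p n := by
  unfold shiftWeight
  positivity

/-- This relation makes the shift carry each term of the random series to the preceding one with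
shifted coordinates. -/
theorem shiftCoeff_succ_mul (n : ℕ) :
    shiftCoeff γ p k₀ (n + 1) * shiftWeight γ p n = shiftCoeff γ p k₀ n := by
  have := (shiftWeight_pos (γ := γ) (p := p) n).ne'
  rw [shiftCoeff, Finset.prod_range_succ, shiftCoeff]
  field_simp

/-- The product of the weights telescopes. -/
theorem shiftCoeff_eq (n : ℕ) :
    shiftCoeff γ p k₀ n = k₀ * ((n : ℝ) + 1) ^ (-(γ / p)) := by
  induction n with
  | zero => simp [shiftCoeff]
  | succ n ih =>
    have h := shiftCoeff_succ_mul (γ := γ) (p := p) (k₀ := k₀) n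
    have hw := (shiftWeight_pos (γ := γ) (p := p) n).ne'
    rw [← eq_div_iff hw] at h
    rw [h, ih, shiftWeight, Real.div_rpow (by positivity) (by positivity),
      Real.rpow_neg (by positivity), Real.rpow_neg (by positivity)]
    push_cast
    rw [show (n : ℝ) + 1 + 1 = n + 2 by ring]
    have h1 : (0 : ℝ) < ((n : ℝ) + 1) ^ (γ / p) := by positivity
    have h2 : (0 : ℝ) < ((n : ℝ) + 2) ^ (γ / p) := by positivity
    field_simp

theorem shiftCoeff_pos (hk₀ : 0 < k₀) (n : ℕ) : 0 < shiftCoeff γ p k₀ n := by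
  rw [shiftCoeff_eq]
  positivity

theorem shiftCoeff_rpow (hk₀ : 0 < k₀) (n : ℕ) (q : ℝ) :
    shiftCoeff γ p k₀ n ^ q = k₀ ^ q * ((n : ℝ) + 1) ^ (-(γ / p) * q) := by
  rw [shiftCoeff_eq, Real.mul_rpow hk₀.le (by positivity), ← Real.rpow_mul (by positivity)]

theorem summable_shiftCoeff_rpow (hk₀ : 0 < k₀) (hp : 0 < p) (hγ : 1 < γ) :
    Summable fun n => |shiftCoeff γ p k₀ n| ^ p := by
  have h : ∀ n, |shiftCoeff γ p k₀ n| ^ p = k₀ ^ p * (((n + 1 : ℕ) : ℝ) ^ (-γ)) := by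
    intro n
    rw [abs_of_pos (shiftCoeff_pos hk₀ n), shiftCoeff_rpow hk₀, neg_mul, div_mul_cancel₀ _ hp.ne']
    push_cast
    rfl
  simp only [h]
  refine Summable.mul_left _ ?_
  exact (summable_nat_add_iff (f := fun n : ℕ => (n : ℝ) ^ (-γ)) 1).2
    (Real.summable_nat_rpow.2 (by linarith))

end Coefficients

/-! ### The random series on the coordinate space -/

section Series

variable {p : ℝ≥0∞}

/-- The coordinate process on `Fin 2 × ℕ → ℝ`. -/
def coordProcess (j : Fin 2) (n : ℕ) (z : Fin 2 × ℕ → ℝ) : ℝ := z (j, n)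

theorem summable_smul_basisVec [Fact (1 ≤ p)] (hp : p ≠ ∞) {c : ℕ → ℂ}
    (hc : Summable fun n => ‖c n‖ ^ p.toReal) : Summable fun n => c n • basisVec p n := by
  have h := (lp.hasSum_single hp (⟨c, memℓp_gen hc⟩ : EllP p)).summable
  refine h.congr fun n => ?_
  rw [basisVec, ← lp.single_smul, smul_eq_mul, mul_one]

theorem norm_add_I_mul_rpow_le {q : ℝ} (hq₀ : 0 ≤ q) (hq₂ : q ≤ 2) (a b : ℝ) :
    ‖(a : ℂ) + Complex.I * (b : ℂ)‖ ^ q ≤ 1 + (a ^ 2 + b ^ 2) := by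
  have h : ‖(a : ℂ) + Complex.I * (b : ℂ)‖ ^ 2 = a ^ 2 + b ^ 2 := by
    rw [Complex.sq_norm, mul_comm, Complex.normSq_add_mul_I]
  rw [← h]
  set c := ‖(a : ℂ) + Complex.I * (b : ℂ)‖
  have hc : 0 ≤ c := norm_nonneg _
  rcases le_total c 1 with h1 | h1
  · have := Real.rpow_le_one hc h1 hq₀
    nlinarith
  · have := Real.rpow_le_rpow_of_exponent_le h1 hq₂
    rw [Real.rpow_two] at this
    linarith

/-- By Tonelli, the expectation of `∑ ‖c n‖ ^ p` is at most `∑ |k n| ^ p` times a constant built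
from the second moment. The coefficients are thus almost surely in `ℓ^p`, where basis expansions
converge. -/
theorem ae_summable_seriesTerm [Fact (1 ≤ p)] (hp : p ≤ 2) {k : ℕ → ℝ}
    (hk : Summable fun n => |k n| ^ p.toReal) {ρ : Measure ℝ} [IsProbabilityMeasure ρ]
    (hρ : ∫⁻ x, ENNReal.ofReal (x ^ 2) ∂ρ < ∞) :
    ∀ᵐ z ∂(Measure.infinitePi fun _ : Fin 2 × ℕ => ρ), Summable (seriesTerm p k coordProcess z) := by
  have hp_top : p ≠ ∞ := (hp.trans_lt ENNReal.ofNat_lt_top).ne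
  have hq₂ : p.toReal ≤ 2 := by simpa using ENNReal.toReal_mono ENNReal.ofNat_ne_top hp
  set Q := Measure.infinitePi fun _ : Fin 2 × ℕ => ρ
  set M := ∫⁻ x, ENNReal.ofReal (x ^ 2) ∂ρ with hM
  let c : ℕ → (Fin 2 × ℕ → ℝ) → ℂ := fun n z =>
    (k n : ℂ) * ((z (0, n) : ℂ) + Complex.I * (z (1, n) : ℂ))
  have hmom : ∀ i, ∫⁻ z, ENNReal.ofReal (z i ^ 2) ∂Q = M := fun i =>
    (measurePreserving_eval_infinitePi (fun _ : Fin 2 × ℕ => ρ) i).lintegral_comp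
      (f := fun x => ENNReal.ofReal (x ^ 2)) (by fun_prop)
  have hle : ∀ n, ∫⁻ z, ENNReal.ofReal (‖c n z‖ ^ p.toReal) ∂Q
      ≤ ENNReal.ofReal (|k n| ^ p.toReal) * (1 + (M + M)) := by
    intro n
    calc _ ≤ ∫⁻ z, ENNReal.ofReal (|k n| ^ p.toReal)
          * (1 + (ENNReal.ofReal (z (0, n) ^ 2) + ENNReal.ofReal (z (1, n) ^ 2))) ∂Q := by
          refine lintegral_mono fun z => ?_
          rw [← ENNReal.ofReal_one, ← ENNReal.ofReal_add (by positivity) (by positivity),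
            ← ENNReal.ofReal_add (by positivity) (by positivity),
            ← ENNReal.ofReal_mul (by positivity)]
          refine ENNReal.ofReal_le_ofReal ?_
          rw [norm_mul, Complex.norm_real, Real.norm_eq_abs,
            Real.mul_rpow (abs_nonneg _) (norm_nonneg _)]
          gcongr
          exact norm_add_I_mul_rpow_le ENNReal.toReal_nonneg hq₂ _ _
      _ = _ := by
          rw [lintegral_const_mul _ (by fun_prop), lintegral_add_left (by fun_prop),
            lintegral_add_left (by fun_prop), hmom, hmom, lintegral_one, measure_univ]
  have hfin : ∫⁻ z, ∑' n, ENNReal.ofReal (‖c n z‖ ^ p.toReal) ∂Q ≠ ∞ := by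
    rw [lintegral_tsum fun n => by fun_prop]
    refine ((ENNReal.tsum_le_tsum hle).trans_lt ?_).ne
    rw [ENNReal.tsum_mul_right, ← ENNReal.ofReal_tsum_of_nonneg (fun n => by positivity) hk]
    exact ENNReal.mul_lt_top ENNReal.ofReal_lt_top (by simp [hρ])
  filter_upwards [ae_lt_top (by fun_prop) hfin] with z hz
  refine summable_smul_basisVec hp_top ((ENNReal.summable_toReal hz.ne).congr fun n => ?_)
  rw [ENNReal.toReal_ofReal (by positivity)]
  rfl

theorem aemeasurable_randomSeries [Fact (1 ≤ p)] [MeasurableSpace (EllP p)] [BorelSpace (EllP p)]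
    {k : ℕ → ℝ} {Q : Measure (Fin 2 × ℕ → ℝ)}
    (h : ∀ᵐ z ∂Q, Summable (seriesTerm p k coordProcess z)) :
    AEMeasurable (randomSeries p k coordProcess) Q := by
  refine AEStronglyMeasurable.aemeasurable ?_
  refine aestronglyMeasurable_of_tendsto_ae atTop
    (f := fun N z => ∑ n ∈ Finset.range N, seriesTerm p k coordProcess z n) (fun N => ?_) ?_
  · refine Continuous.aestronglyMeasurable ?_
    unfold seriesTerm coordProcess
    fun_prop
  · filter_upwards [h] with z hz
    exact hz.hasSum.tendsto_sum_nat

section Shift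

variable [Fact (1 ≤ p)] {k w : ℕ → ℝ} {C : ℝ} {hC : 0 ≤ C} {hw : ∀ n, |w n| ≤ C}

theorem weightedBackwardShift_seriesTerm_succ (hkw : ∀ n, k (n + 1) * w n = k n)
    (z : Fin 2 × ℕ → ℝ) (n : ℕ) :
    weightedBackwardShift p w C hC hw (seriesTerm p k coordProcess z (n + 1))
      = seriesTerm p k coordProcess (coordShift z) n := by
  rw [seriesTerm, map_smul, weightedBackwardShift_basisVec_succ, smul_smul, seriesTerm]
  congr 1
  rw [mul_right_comm, ← Complex.ofReal_mul, hkw]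
  rfl

theorem weightedBackwardShift_seriesTerm_zero (z : Fin 2 × ℕ → ℝ) :
    weightedBackwardShift p w C hC hw (seriesTerm p k coordProcess z 0) = 0 := by
  rw [seriesTerm, map_smul, weightedBackwardShift_basisVec_zero, smul_zero]

theorem hasSum_seriesTerm_coordShift (hkw : ∀ n, k (n + 1) * w n = k n) {z : Fin 2 × ℕ → ℝ}
    (hz : Summable (seriesTerm p k coordProcess z)) :
    HasSum (seriesTerm p k coordProcess (coordShift z))
      (weightedBackwardShift p w C hC hw (randomSeries p k coordProcess z)) := by
  have h := (weightedBackwardShift p w C hC hw).hasSum hz.hasSum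
  rw [← hasSum_nat_add_iff' 1] at h
  simpa [weightedBackwardShift_seriesTerm_succ hkw, weightedBackwardShift_seriesTerm_zero,
    randomSeries] using h

theorem weightedBackwardShift_iterate_randomSeries (hkw : ∀ n, k (n + 1) * w n = k n)
    {z : Fin 2 × ℕ → ℝ} (hz : Summable (seriesTerm p k coordProcess z)) (n : ℕ) :
    (weightedBackwardShift p w C hC hw)^[n] (randomSeries p k coordProcess z)
      = randomSeries p k coordProcess (coordShift^[n] z) := by
  induction n generalizing z with
  | zero => rfl
  | succ n ih =>
    have h := hasSum_seriesTerm_coordShift (hC := hC) (hw := hw) hkw hz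
    -- Convergence at `z` passes to `coordShift z` pointwise, so a single null set serves all
    -- iterates.
    rw [Function.iterate_succ_apply, Function.iterate_succ_apply, ← ih h.summable]
    congr 1
    exact h.tsum_eq.symm

theorem isStronglyMixing_weightedBackwardShift [MeasurableSpace (EllP p)] [BorelSpace (EllP p)]
    (hkw : ∀ n, k (n + 1) * w n = k n) {ρ : Measure ℝ} [IsProbabilityMeasure ρ]
    (h : ∀ᵐ z ∂(Measure.infinitePi fun _ : Fin 2 × ℕ => ρ),
      Summable (seriesTerm p k coordProcess z)) :
    IsStronglyMixing (weightedBackwardShift p w C hC hw)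
      ((Measure.infinitePi fun _ : Fin 2 × ℕ => ρ).map (randomSeries p k coordProcess)) := by
  refine isStronglyMixing_coordShift.of_factor
    (weightedBackwardShift p w C hC hw).continuous.measurable (aemeasurable_randomSeries h) ?_
  filter_upwards [h] with z hz n
  exact weightedBackwardShift_iterate_randomSeries hkw hz n

/-- The iterates of the shift move the coefficients of a functional by `n`. -/
theorem coeff_mul_comp_pow_apply (hkw : ∀ n, k (n + 1) * w n = k n) (y : EllP p →L[ℂ] ℂ)
    (n j : ℕ) :
    (k (j + n) : ℂ) * (y.comp (weightedBackwardShift p w C hC hw ^ n)) (basisVec p (j + n))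
      = (k j : ℂ) * y (basisVec p j) := by
  induction n with
  | zero => simp
  | succ n ih =>
    rw [← ih, pow_succ]
    simp only [ContinuousLinearMap.comp_apply, mul_apply_eq_comp]
    rw [← add_assoc, weightedBackwardShift_basisVec_succ, map_smul, map_smul, smul_eq_mul,
      ← mul_assoc, ← Complex.ofReal_mul, hkw]

theorem comp_pow_apply_basisVec_eq_zero (y : EllP p →L[ℂ] ℂ) {n m : ℕ} (hm : m < n) :
    (y.comp (weightedBackwardShift p w C hC hw ^ n)) (basisVec p m) = 0 := by
  have h : ∀ n m : ℕ, m < n → (weightedBackwardShift p w C hC hw ^ n) (basisVec p m) = 0 := by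
    intro n
    induction n with
    | zero => simp
    | succ n ih =>
      intro m hm
      rw [pow_succ, mul_apply_eq_comp]
      cases m with
      | zero => rw [weightedBackwardShift_basisVec_zero, map_zero]
      | succ m =>
        rw [weightedBackwardShift_basisVec_succ, map_smul, ih m (by omega), smul_zero]
  rw [ContinuousLinearMap.comp_apply, h n m hm, map_zero]

end Shift

end Series

/-! ### The logarithm of the characteristic functional -/

section LogCharFun

variable {p : ℝ≥0∞} [Fact (1 ≤ p)] {k : ℕ → ℝ} {ρ : Measure ℝ} {ψ : ℝ → ℂ} {L : ℝ}

/-- `∑ k n • e_n` converges unconditionally in `ℓ^p`; a continuous functional maps it to an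
unconditionally, hence absolutely, convergent scalar series. -/
theorem summable_norm_coeff_mul_apply (hp : p ≠ ∞) (hk : Summable fun n => |k n| ^ p.toReal)
    (x : EllP p →L[ℂ] ℂ) : Summable fun n => ‖(k n : ℂ) * x (basisVec p n)‖ := by
  have h := summable_smul_basisVec (p := p) hp (c := fun n => (k n : ℂ)) (by simpa using hk)
  refine (h.map x x.continuous).norm.congr fun n => ?_
  simp

/-- The frequencies at which the functional `Re x` reads the coordinate process. -/
noncomputable def functionalFreq (k : ℕ → ℝ) (x : EllP p →L[ℂ] ℂ) (i : Fin 2 × ℕ) : ℝ :=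
  if i.1 = 0 then ((k i.2 : ℂ) * x (basisVec p i.2)).re
  else -((k i.2 : ℂ) * x (basisVec p i.2)).im

theorem abs_functionalFreq_le (x : EllP p →L[ℂ] ℂ) (i : Fin 2 × ℕ) :
    |functionalFreq k x i| ≤ ‖(k i.2 : ℂ) * x (basisVec p i.2)‖ := by
  unfold functionalFreq
  split_ifs
  · exact Complex.abs_re_le_norm _
  · rw [abs_neg]
    exact Complex.abs_im_le_norm _

theorem functionalFreq_sub (x y : EllP p →L[ℂ] ℂ) (i : Fin 2 × ℕ) :
    functionalFreq k (x - y) i = functionalFreq k x i - functionalFreq k y i := by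
  unfold functionalFreq
  split_ifs
  · simp [mul_sub]
  · simp [mul_sub]
    ring

theorem functionalFreq_neg (y : EllP p →L[ℂ] ℂ) (i : Fin 2 × ℕ) :
    functionalFreq k (-y) i = -functionalFreq k y i := by
  unfold functionalFreq
  split_ifs <;> simp

theorem re_apply_seriesTerm (x : EllP p →L[ℂ] ℂ) (z : Fin 2 × ℕ → ℝ) (n : ℕ) :
    (x (seriesTerm p k coordProcess z n)).re = ∑ j, functionalFreq k x (j, n) * z (j, n) := by
  simp [seriesTerm, coordProcess, functionalFreq]
  ring

/-- The candidate for the logarithm of the characteristic function of `Re x`. -/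
noncomputable def functionalLog (ψ : ℝ → ℂ) (k : ℕ → ℝ) (x : EllP p →L[ℂ] ℂ) (t : ℝ) : ℂ :=
  ∑' n, ∑ j, ψ (t * functionalFreq k x (j, n))

theorem norm_functionalLog_term_sub_le (hψ : ∀ s t, ‖ψ s - ψ t‖ ≤ L * |s - t|)
    (x : EllP p →L[ℂ] ℂ) (s t : ℝ) (n : ℕ) :
    ‖∑ j, ψ (s * functionalFreq k x (j, n)) - ∑ j, ψ (t * functionalFreq k x (j, n))‖
      ≤ 2 * L * |s - t| * ‖(k n : ℂ) * x (basisVec p n)‖ := by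
  have hL : 0 ≤ L := by simpa using (norm_nonneg _).trans (hψ 1 0)
  rw [← Finset.sum_sub_distrib]
  calc _ ≤ ∑ j : Fin 2, L * |s - t| * ‖(k n : ℂ) * x (basisVec p n)‖ := by
        refine norm_sum_le_of_le _ fun j _ => (hψ _ _).trans ?_
        rw [← sub_mul, abs_mul, mul_assoc]
        gcongr
        exact abs_functionalFreq_le x (j, n)
    _ = _ := by
        simp
        ring

theorem summable_functionalLog (hψ : ∀ s t, ‖ψ s - ψ t‖ ≤ L * |s - t|) (hψ₀ : ψ 0 = 0)
    (hp : p ≠ ∞) (hk : Summable fun n => |k n| ^ p.toReal) (x : EllP p →L[ℂ] ℂ) (t : ℝ) :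
    Summable fun n => ∑ j, ψ (t * functionalFreq k x (j, n)) := by
  refine Summable.of_norm_bounded
    ((summable_norm_coeff_mul_apply hp hk x).mul_left (2 * L * |t|)) fun n => ?_
  simpa [hψ₀] using norm_functionalLog_term_sub_le hψ x t 0 n

/-- The Lipschitz bounds of the terms are summable, so the sum is itself Lipschitz in `t`. -/
theorem continuous_functionalLog (hψ : ∀ s t, ‖ψ s - ψ t‖ ≤ L * |s - t|) (hψ₀ : ψ 0 = 0)
    (hp : p ≠ ∞) (hk : Summable fun n => |k n| ^ p.toReal) (x : EllP p →L[ℂ] ℂ) :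
    Continuous (functionalLog ψ k x) := by
  have hs := summable_norm_coeff_mul_apply hp hk x
  refine LipschitzWith.continuous (K := Real.toNNReal
    (2 * L * ∑' n, ‖(k n : ℂ) * x (basisVec p n)‖)) (LipschitzWith.of_dist_le' fun s t => ?_)
  rw [dist_eq_norm, Real.dist_eq, functionalLog, functionalLog,
    ← (summable_functionalLog hψ hψ₀ hp hk x s).tsum_sub (summable_functionalLog hψ hψ₀ hp hk x t)]
  refine (tsum_of_norm_bounded (hs.mul_left (2 * L * |s - t|)).hasSum
    fun n => norm_functionalLog_term_sub_le hψ x s t n).trans ?_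
  rw [tsum_mul_left]
  exact le_of_eq (by ring)

theorem integral_exp_sum_mul_eval [IsProbabilityMeasure ρ]
    (hρ : ∀ t, charFun ρ t = Complex.exp (ψ t)) (c : Fin 2 × ℕ → ℝ) (s : Finset (Fin 2 × ℕ))
    (t : ℝ) :
    ∫ z, Complex.exp (Complex.I * (t * ∑ i ∈ s, c i * z i : ℝ))
        ∂(Measure.infinitePi fun _ : Fin 2 × ℕ => ρ)
      = Complex.exp (∑ i ∈ s, ψ (t * c i)) := by
  set Q := Measure.infinitePi fun _ : Fin 2 × ℕ => ρ
  have hind : iIndepFun (fun i z => c i * z i) Q :=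
    iIndepFun_infinitePi (P := fun _ : Fin 2 × ℕ => ρ) (X := fun i x => c i * x) fun _ => by fun_prop
  have h := congrFun ((hind.restrict s).charFun_map_fun_finsetSum_eq_prod
    (X := fun i (z : Fin 2 × ℕ → ℝ) => c i * z i) fun i _ => Measurable.aemeasurable (by fun_prop)) t
  rw [charFun_apply_real, integral_map (Measurable.aemeasurable (by fun_prop))
    (Measurable.aestronglyMeasurable (by fun_prop))] at h
  rw [Complex.exp_sum]
  refine Eq.trans ?_ (h.trans ?_)
  · congr 1
    funext z
    push_cast
    ring_nf
  · rw [Finset.prod_apply]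
    refine Finset.prod_congr rfl fun i _ => ?_
    have h1 : Q.map (fun z => c i * z i) = ρ.map (fun u => c i * u) := by
      rw [← Measure.infinitePi_map_eval (fun _ : Fin 2 × ℕ => ρ) i,
        Measure.map_map (by fun_prop) (by fun_prop)]
      rfl
    rw [h1, charFun_map_mul, hρ, mul_comm]

variable [MeasurableSpace (EllP p)] [BorelSpace (EllP p)]

/-- Partial sums have characteristic functions that factor by independence. Both sides are limits of
these: one by dominated convergence, one by summability of the exponents. -/
theorem realCharFun_randomSeries [IsProbabilityMeasure ρ]
    (hρ : ∀ t, charFun ρ t = Complex.exp (ψ t)) (hψ : ∀ s t, ‖ψ s - ψ t‖ ≤ L * |s - t|)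
    (hψ₀ : ψ 0 = 0) (hp : p ≠ ∞) (hk : Summable fun n => |k n| ^ p.toReal)
    (hsum : ∀ᵐ z ∂(Measure.infinitePi fun _ : Fin 2 × ℕ => ρ),
      Summable (seriesTerm p k coordProcess z)) (x : EllP p →L[ℂ] ℂ) (t : ℝ) :
    realCharFun ((Measure.infinitePi fun _ : Fin 2 × ℕ => ρ).map (randomSeries p k coordProcess))
      (fun z => (x z).re) t = Complex.exp (functionalLog ψ k x t) := by
  set Q := Measure.infinitePi fun _ : Fin 2 × ℕ => ρ
  let F : ℕ → (Fin 2 × ℕ → ℝ) → ℂ := fun N z => Complex.exp (Complex.I *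
    (t * ∑ i ∈ Finset.range N ×ˢ (Finset.univ : Finset (Fin 2)),
      functionalFreq k x i.swap * z i.swap : ℝ))
  have hF : ∀ N, ∫ z, F N z ∂Q
      = Complex.exp (∑ n ∈ Finset.range N, ∑ j, ψ (t * functionalFreq k x (j, n))) := by
    intro N
    have h := integral_exp_sum_mul_eval hρ (functionalFreq k x)
      ((Finset.range N ×ˢ (Finset.univ : Finset (Fin 2))).map (Equiv.prodComm _ _).toEmbedding) t
    simp only [Finset.sum_map] at h
    refine h.trans ?_
    rw [Finset.sum_product]
    rfl
  have hlim₁ : Tendsto (fun N => ∫ z, F N z ∂Q) atTop (𝓝 (Complex.exp (functionalLog ψ k x t))) := by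
    simp only [hF]
    exact (Complex.continuous_exp.tendsto _).comp
      (summable_functionalLog hψ hψ₀ hp hk x t).hasSum.tendsto_sum_nat
  have hlim₂ : Tendsto (fun N => ∫ z, F N z ∂Q) atTop
      (𝓝 (∫ z, Complex.exp (Complex.I * (t * (x (randomSeries p k coordProcess z)).re : ℝ)) ∂Q)) := by
    refine tendsto_integral_of_dominated_convergence (fun _ => 1)
      (fun N => Measurable.aestronglyMeasurable (by fun_prop)) (integrable_const _)
      (fun N => Eventually.of_forall fun z => ?_) ?_
    · simp only [F]
      rw [mul_comm, Complex.norm_exp_ofReal_mul_I]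
    · filter_upwards [hsum] with z hz
      have h1 := (hz.hasSum.mapL (Complex.reCLM.comp (x.restrictScalars ℝ))).tendsto_sum_nat
      have h2 : ∀ n, (Complex.reCLM.comp (x.restrictScalars ℝ)) (seriesTerm p k coordProcess z n)
          = ∑ j, functionalFreq k x (j, n) * z (j, n) := re_apply_seriesTerm x z
      simp only [h2] at h1
      have h3 : Continuous fun r : ℝ => Complex.exp (Complex.I * (t * r : ℝ)) := by fun_prop
      refine ((h3.tendsto _).comp h1).congr fun N => ?_
      simp only [Function.comp_apply, F, Finset.sum_product]
      rfl
  rw [realCharFun, integral_map (aemeasurable_randomSeries hsum)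
    (Continuous.aestronglyMeasurable (by fun_prop))]
  exact tendsto_nhds_unique hlim₂ hlim₁

theorem isDistinguishedLog_functionalLog [IsProbabilityMeasure ρ]
    (hρ : ∀ t, charFun ρ t = Complex.exp (ψ t)) (hψ : ∀ s t, ‖ψ s - ψ t‖ ≤ L * |s - t|)
    (hψ₀ : ψ 0 = 0) (hp : p ≠ ∞) (hk : Summable fun n => |k n| ^ p.toReal)
    (hsum : ∀ᵐ z ∂(Measure.infinitePi fun _ : Fin 2 × ℕ => ρ),
      Summable (seriesTerm p k coordProcess z)) (x : EllP p →L[ℂ] ℂ) :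
    IsDistinguishedLog (realCharFun ((Measure.infinitePi fun _ : Fin 2 × ℕ => ρ).map
      (randomSeries p k coordProcess)) (fun z => (x z).re)) (functionalLog ψ k x) :=
  ⟨continuous_functionalLog hψ hψ₀ hp hk x, by simp [functionalLog, hψ₀],
    fun t => (realCharFun_randomSeries hρ hψ hψ₀ hp hk hsum x t).symm⟩

/-- The bound on `ψ` is applied at every coordinate; the factor `2` counts the real and imaginary
noises at each index. -/
theorem norm_codifference_randomSeries_le [IsProbabilityMeasure ρ]
    (hρ : ∀ t, charFun ρ t = Complex.exp (ψ t)) (hψ : ∀ s t, ‖ψ s - ψ t‖ ≤ L * |s - t|)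
    (hψ₀ : ψ 0 = 0) (hp : p ≠ ∞) (hk : Summable fun n => |k n| ^ p.toReal)
    (hsum : ∀ᵐ z ∂(Measure.infinitePi fun _ : Fin 2 × ℕ => ρ),
      Summable (seriesTerm p k coordProcess z)) {D q R : ℝ} (hD : 0 ≤ D) (hq : 0 ≤ q)
    (hcod : ∀ s t, ‖ψ (s - t) - ψ s - ψ (-t)‖ ≤ D * (|s| ^ q * |t| ^ q))
    (x y : EllP p →L[ℂ] ℂ)
    (hR : ∀ N, ∑ n ∈ Finset.range N, ‖(k n : ℂ) * x (basisVec p n)‖ ^ q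
      * ‖(k n : ℂ) * y (basisVec p n)‖ ^ q ≤ R) :
    ‖codifference ((Measure.infinitePi fun _ : Fin 2 × ℕ => ρ).map
      (randomSeries p k coordProcess)) x y‖ ≤ 2 * D * R := by
  have hlog : ∀ x : EllP p →L[ℂ] ℂ, logIntegralExp ((Measure.infinitePi fun _ : Fin 2 × ℕ => ρ).map
      (randomSeries p k coordProcess)) (fun z => (x z).re) = functionalLog ψ k x 1 := fun x => by
    rw [logIntegralExp,
      distinguishedLog_eq (isDistinguishedLog_functionalLog hρ hψ hψ₀ hp hk hsum x)]
  have hs := fun x => (summable_functionalLog hψ hψ₀ hp hk x 1).hasSum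
  have h := (((hs (x - y)).sub (hs x)).sub (hs (-y))).tendsto_sum_nat.norm
  have hneg : (fun z : EllP p => -(y z).re) = fun z => ((-y) z).re := by
    funext z
    simp
  rw [codifference, hlog, hlog, hneg, hlog]
  refine le_of_tendsto h (Eventually.of_forall fun N => ?_)
  calc _ ≤ ∑ n ∈ Finset.range N, 2 * D * (‖(k n : ℂ) * x (basisVec p n)‖ ^ q
        * ‖(k n : ℂ) * y (basisVec p n)‖ ^ q) := by
        refine norm_sum_le_of_le _ fun n _ => ?_
        rw [← Finset.sum_sub_distrib, ← Finset.sum_sub_distrib]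
        refine (norm_sum_le_of_le (f := fun j => _) (n := fun _ : Fin 2 =>
          D * (‖(k n : ℂ) * x (basisVec p n)‖ ^ q * ‖(k n : ℂ) * y (basisVec p n)‖ ^ q)) _
          fun j _ => ?_).trans ?_
        · simp only [one_mul, functionalFreq_sub, functionalFreq_neg]
          refine (hcod _ _).trans ?_
          gcongr
          · exact abs_functionalFreq_le x (j, n)
          · exact abs_functionalFreq_le y (j, n)
        · simp
          exact le_of_eq (by ring)
    _ ≤ _ := by
        rw [← Finset.mul_sum]
        gcongr
        exact hR N

end LogCharFun

/-! ### Decay of the codifference and the main theorem -/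

theorem norm_basisVec {p : ℝ≥0∞} [Fact (1 ≤ p)] (n : ℕ) : ‖basisVec p n‖ = 1 := by
  rw [basisVec, lp.norm_single (zero_lt_one.trans_le Fact.out), norm_one]

/-- Correlations of the coefficients of `x` and of `y ∘ T^n`. -/
theorem sum_norm_rpow_mul_norm_rpow_comp_pow_le {p : ℝ≥0∞} [Fact (1 ≤ p)] {k w : ℕ → ℝ} {C : ℝ}
    {hC : 0 ≤ C} {hw : ∀ n, |w n| ≤ C} (hkw : ∀ n, k (n + 1) * w n = k n) {q R : ℝ} (hq : 0 < q)
    (x y : EllP p →L[ℂ] ℂ) (n : ℕ)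
    (hR : ∀ N, ∑ j ∈ Finset.range N, |k j| ^ q * |k (j + n)| ^ q ≤ R) (N : ℕ) :
    ∑ m ∈ Finset.range N, ‖(k m : ℂ) * x (basisVec p m)‖ ^ q
      * ‖(k m : ℂ) * (y.comp (weightedBackwardShift p w C hC hw ^ n)) (basisVec p m)‖ ^ q
      ≤ R * (‖x‖ ^ q * ‖y‖ ^ q) := by
  have hle : ∀ (x : EllP p →L[ℂ] ℂ) m, ‖(k m : ℂ) * x (basisVec p m)‖ ^ q ≤ |k m| ^ q * ‖x‖ ^ q := by
    intro x m
    rw [← Real.mul_rpow (abs_nonneg _) (norm_nonneg _)]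
    refine Real.rpow_le_rpow (norm_nonneg _) ?_ hq.le
    rw [norm_mul, Complex.norm_real, Real.norm_eq_abs]
    gcongr
    simpa [norm_basisVec] using x.le_opNorm (basisVec p m)
  set f : ℕ → ℝ := fun m => ‖(k m : ℂ) * x (basisVec p m)‖ ^ q
      * ‖(k m : ℂ) * (y.comp (weightedBackwardShift p w C hC hw ^ n)) (basisVec p m)‖ ^ q with hf
  have hf₀ : ∀ m, 0 ≤ f m := fun m => by positivity
  -- The first `n` terms vanish because `T ^ n` kills the corresponding basis vectors; enlarging the
  -- range to `n + N` leaves exactly `N` terms after reindexing.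
  calc ∑ m ∈ Finset.range N, f m ≤ ∑ m ∈ Finset.range (n + N), f m :=
        Finset.sum_le_sum_of_subset_of_nonneg
          (Finset.range_mono (Nat.le_add_left N n)) fun m _ _ => hf₀ m
    _ = ∑ j ∈ Finset.range N, f (j + n) := by
        rw [Finset.sum_range_add, Finset.sum_eq_zero, zero_add]
        · simp only [add_comm n]
        · intro m hm
          rw [hf]
          simp only
          rw [comp_pow_apply_basisVec_eq_zero y (Finset.mem_range.1 hm), mul_zero, norm_zero,
            Real.zero_rpow hq.ne', mul_zero]
    _ ≤ ∑ j ∈ Finset.range N, (|k j| ^ q * |k (j + n)| ^ q) * (‖x‖ ^ q * ‖y‖ ^ q) := by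
        refine Finset.sum_le_sum fun j _ => ?_
        rw [hf]
        simp only
        rw [coeff_mul_comp_pow_apply hkw]
        calc _ ≤ (|k (j + n)| ^ q * ‖x‖ ^ q) * (|k j| ^ q * ‖y‖ ^ q) := by
              gcongr
              · exact hle x _
              · exact hle y _
          _ = _ := by ring
    _ ≤ _ := by
        rw [← Finset.sum_mul]
        gcongr
        exact hR N

/-- Correlations of the coefficients `k_n` for any exponent `γ' ∈ (1, 2)` with `γ' ≤ γ`. -/
theorem sum_shiftCoeff_rpow_le {γ γ' p k₀ : ℝ} (hp : 0 < p) (hk₀ : 0 < k₀) (h₁ : 1 < γ')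
    (h₂ : γ' < 2) (hγ : γ' ≤ γ) {n : ℕ} (hn : 1 ≤ n) (N : ℕ) :
    ∑ j ∈ Finset.range N, |shiftCoeff γ p k₀ j| ^ (p / 2) * |shiftCoeff γ p k₀ (j + n)| ^ (p / 2)
      ≤ k₀ ^ p * (beta (1 - γ' / 2) (γ' - 1) * (n : ℝ) ^ (-(γ' - 1))) := by
  refine le_trans ?_ (mul_le_mul_of_nonneg_left (sum_rpow_mul_add_rpow_le h₁ h₂ hn N)
    (Real.rpow_nonneg hk₀.le p))
  rw [Finset.mul_sum]
  refine Finset.sum_le_sum fun j _ => ?_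
  have hexp : -(γ / p) * (p / 2) = -(γ / 2) := by field_simp
  rw [abs_of_pos (shiftCoeff_pos hk₀ _), abs_of_pos (shiftCoeff_pos hk₀ _), shiftCoeff_rpow hk₀,
    shiftCoeff_rpow hk₀, hexp, mul_mul_mul_comm, ← Real.rpow_add hk₀, add_halves]
  -- All bases are at least `1`, so lowering `γ` to `γ'` can only increase the powers.
  have h : ∀ r : ℝ, 1 ≤ r → r ^ (-(γ / 2)) ≤ r ^ (-(γ' / 2)) := fun r hr =>
    Real.rpow_le_rpow_of_exponent_le hr (by linarith)
  have hj : (0 : ℝ) ≤ j := Nat.cast_nonneg j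
  have hn0 : (0 : ℝ) ≤ n := Nat.cast_nonneg n
  have e : ((j + n : ℕ) : ℝ) + 1 = (j : ℝ) + 1 + n := by push_cast; ring
  rw [e]
  refine mul_le_mul_of_nonneg_left ?_ (Real.rpow_nonneg hk₀.le p)
  exact mul_le_mul (h _ (by linarith)) (h _ (by linarith)) (by positivity) (by positivity)

theorem seriesTerm_eq_coordProcess {Ω : Type*} {p : ℝ≥0∞} (k : ℕ → ℝ) (θ : Fin 2 → ℕ → Ω → ℝ)
    (ω : Ω) : seriesTerm p k θ ω = seriesTerm p k coordProcess fun i => θ i.1 i.2 ω := rfl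

theorem randomSeries_eq_comp_coordProcess {Ω : Type*} {p : ℝ≥0∞} [Fact (1 ≤ p)] (k : ℕ → ℝ)
    (θ : Fin 2 → ℕ → Ω → ℝ) :
    randomSeries p k θ
      = randomSeries p k coordProcess ∘ fun ω (i : Fin 2 × ℕ) => θ i.1 i.2 ω := by
  funext ω
  rw [randomSeries, seriesTerm_eq_coordProcess]
  rfl

theorem mainTheorem9 {Ω : Type*} [MeasurableSpace Ω] (P : Measure Ω) [IsProbabilityMeasure P]
    (p : ℝ≥0∞) [Fact (1 ≤ p)] (hp : p ≤ 2)
    [MeasurableSpace (EllP p)] [BorelSpace (EllP p)]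
    (α aₙ aₚ lₙ lₚ γ k₀ : ℝ) (hα₀ : 0 < α) (hα₁ : α < 1)
    (haₙ : 0 < aₙ) (haₚ : 0 < aₚ) (hlₙ : 0 < lₙ) (hlₚ : 0 < lₚ)
    (hγ : 1 < γ) (hk₀ : 0 < k₀)
    (θ : Fin 2 → ℕ → Ω → ℝ) (hθm : ∀ j n, Measurable (θ j n))
    (hθi : iIndepFun (fun i : Fin 2 × ℕ => θ i.1 i.2) P)
    (hθ : ∀ j n, IsTemperedStable α aₙ aₚ lₙ lₚ (P.map (θ j n)))
    (X : Ω → EllP p) (hX : X = randomSeries p (shiftCoeff γ p.toReal k₀) θ)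
    (μ : Measure (EllP p)) (hμ : μ = P.map X)
    (T : EllP p →L[ℂ] EllP p) (hT : T = powerShift p γ hγ)
    (K : ℝ) (hK : K = (2 : ℝ) ^ (5 - p.toReal)
      * (aₙ * lₙ ^ (α - p.toReal) + aₚ * lₚ ^ (α - p.toReal))
      * Real.Gamma (p.toReal - α) * k₀ ^ p.toReal) :
    -- the series defining `μ` converges almost surely in `ℓ^p(ℕ)`
    (∀ᵐ ω ∂P, Summable (seriesTerm p (shiftCoeff γ p.toReal k₀) θ ω)) ∧
    AEMeasurable X P ∧
    -- `μ` is an invariant probability measure and `T` is mixing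
    IsProbabilityMeasure μ ∧
    MeasurePreserving T μ μ ∧
    IsStronglyMixing T μ ∧
    -- the logarithms in the codifference exist
    (∀ x : EllP p →L[ℂ] ℂ, ∃ ψ, IsDistinguishedLog (realCharFun μ (fun z => (x z).re)) ψ) ∧
    -- decay of the normalized codifference; `T^{*n} y^* = y^* ∘ T^n`
    (γ < 2 → ∀ n : ℕ, 1 ≤ n → ∀ x y : EllP p →L[ℂ] ℂ, x ≠ 0 → y ≠ 0 →
      ‖codifference μ x (y.comp (T ^ n))‖ / (‖x‖ ^ (p.toReal / 2) * ‖y‖ ^ (p.toReal / 2))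
        ≤ K * ProbabilityTheory.beta (1 - γ / 2) (γ - 1) * (n : ℝ) ^ (-(γ - 1))) ∧
    (2 ≤ γ → ∀ ε : ℝ, 0 < ε → ε < 1 →
      ∀ n : ℕ, 1 ≤ n → ∀ x y : EllP p →L[ℂ] ℂ, x ≠ 0 → y ≠ 0 →
      ‖codifference μ x (y.comp (T ^ n))‖ / (‖x‖ ^ (p.toReal / 2) * ‖y‖ ^ (p.toReal / 2))
        ≤ K * ProbabilityTheory.beta (ε / 2) (1 - ε) * (n : ℝ) ^ (-(1 - ε))) := by
  subst hT hK
  have hp_top : p ≠ ∞ := (hp.trans_lt ENNReal.ofNat_lt_top).ne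
  have hq₁ : 1 ≤ p.toReal := by
    simpa using ENNReal.toReal_mono hp_top (Fact.out : 1 ≤ p)
  have hq₂ : p.toReal ≤ 2 := by simpa using ENNReal.toReal_mono ENNReal.ofNat_ne_top hp
  have hq₀ : 0 < p.toReal := zero_lt_one.trans_le hq₁
  set k := shiftCoeff γ p.toReal k₀
  have hk : Summable fun n => |k n| ^ p.toReal := summable_shiftCoeff_rpow hk₀ hq₀ hγ
  have hkw : ∀ n, k (n + 1) * shiftWeight γ p.toReal n = k n := shiftCoeff_succ_mul
  set ν := temperedLevyMeasure α aₙ aₚ lₙ lₚ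
  set ρ := P.map (θ 0 0)
  have hρ : IsTemperedStable α aₙ aₚ lₙ lₚ ρ := hθ 0 0
  have := hρ.1
  -- The characteristic function determines the law, so all the noises share the law of `θ 0 0`, and
  -- joint independence gives the product measure `Q`.
  have hlaw : ∀ i : Fin 2 × ℕ, P.map (θ i.1 i.2) = ρ := fun i => by
    have := (hθ i.1 i.2).1
    refine Measure.ext_of_charFun (funext fun t => ?_)
    rw [(hθ i.1 i.2).2, hρ.2]
  set Q := Measure.infinitePi fun _ : Fin 2 × ℕ => ρ with hQ_def
  have hΘm : Measurable fun ω (i : Fin 2 × ℕ) => θ i.1 i.2 ω :=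
    measurable_pi_lambda _ fun i => hθm i.1 i.2
  have hΘ : MeasurePreserving (fun ω (i : Fin 2 × ℕ) => θ i.1 i.2 ω) P Q := by
    refine ⟨hΘm, ?_⟩
    rw [hθi.map_fun_eq_infinitePi_map fun i : Fin 2 × ℕ => hθm i.1 i.2]
    simp only [hlaw, hQ_def]
  have hsum : ∀ᵐ z ∂Q, Summable (seriesTerm p k coordProcess z) :=
    ae_summable_seriesTerm hp hk (hρ.lintegral_sq_lt_top hα₁ haₙ.le haₚ.le hlₙ hlₚ)
  have hGm := aemeasurable_randomSeries hsum
  have hXm : AEMeasurable X P := by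
    rw [hX, randomSeries_eq_comp_coordProcess]
    exact hGm.comp_quasiMeasurePreserving hΘ.quasiMeasurePreserving
  have hμQ : μ = Q.map (randomSeries p k coordProcess) := by
    have hGm' : AEMeasurable (randomSeries p k coordProcess)
        (P.map fun ω (i : Fin 2 × ℕ) => θ i.1 i.2 ω) := by rwa [hΘ.map_eq]
    rw [hμ, hX, randomSeries_eq_comp_coordProcess, ← hΘ.map_eq,
      AEMeasurable.map_map_of_aemeasurable hGm' hΘm.aemeasurable]
  have hmix : IsStronglyMixing (powerShift p γ hγ) μ := by
    rw [hμQ]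
    exact isStronglyMixing_weightedBackwardShift hkw hsum
  have hν₁ : Integrable (fun x : ℝ => |x|) ν := by
    simpa using integrable_abs_rpow_temperedLevyMeasure haₙ.le haₚ.le hlₙ hlₚ hα₁
  have hνp := integrable_abs_rpow_temperedLevyMeasure haₙ.le haₚ.le hlₙ hlₚ (hα₁.trans_le hq₁)
  have hD : ∫ x, |x| ^ p.toReal ∂ν = _ :=
    integral_abs_rpow_temperedLevyMeasure haₙ.le haₚ.le hlₙ hlₚ (hα₁.trans_le hq₁)
  set M := (aₙ * lₙ ^ (α - p.toReal) + aₚ * lₚ ^ (α - p.toReal)) * Real.Gamma (p.toReal - α)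
    with hM_def
  have hM : 0 ≤ M := by
    have := Real.Gamma_pos_of_pos (sub_pos.2 (hα₁.trans_le hq₁))
    positivity
  have hchar : ∀ t, charFun ρ t = Complex.exp (levyExponent ν t) := hρ.2
  -- Both regimes at once: `γ' = γ` when `γ < 2`, and `γ' = 2 - ε` otherwise.
  have hbound : ∀ γ' : ℝ, 1 < γ' → γ' < 2 → γ' ≤ γ → ∀ n : ℕ, 1 ≤ n → ∀ x y : EllP p →L[ℂ] ℂ,
      x ≠ 0 → y ≠ 0 →
      ‖codifference μ x (y.comp (powerShift p γ hγ ^ n))‖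
        / (‖x‖ ^ (p.toReal / 2) * ‖y‖ ^ (p.toReal / 2))
      ≤ 2 ^ (5 - p.toReal) * (aₙ * lₙ ^ (α - p.toReal) + aₚ * lₚ ^ (α - p.toReal))
        * Real.Gamma (p.toReal - α) * k₀ ^ p.toReal
        * beta (1 - γ' / 2) (γ' - 1) * (n : ℝ) ^ (-(γ' - 1)) := by
    intro γ' h₁ h₂ h₃ n hn x y hx hy
    have hx' := norm_pos_iff.2 hx
    have hy' := norm_pos_iff.2 hy
    have hB := beta_pos (show 0 < 1 - γ' / 2 by linarith) (show 0 < γ' - 1 by linarith)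
    rw [div_le_iff₀ (by positivity), hμQ]
    have h := norm_codifference_randomSeries_le hchar (norm_levyExponent_sub_le hν₁)
      levyExponent_zero hp_top hk hsum (D := 2 ^ (2 - p.toReal) * M) (q := p.toReal / 2)
      (by positivity) (by positivity)
      (fun s t => by
        simpa only [hD] using norm_levyExponent_codifference_le hν₁ hq₀.le hq₂ hνp s t)
      x (y.comp (powerShift p γ hγ ^ n))
      (sum_norm_rpow_mul_norm_rpow_comp_pow_le hkw (by positivity) x y n
        (sum_shiftCoeff_rpow_le hq₀ hk₀ h₁ h₂ h₃ hn))
    refine h.trans ?_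
    -- The estimate obtained has `2 ^ (3 - p)`; the stated constant leaves a spare factor `4`.
    have h2 : (2 : ℝ) ^ (5 - p.toReal) = 4 * (2 * 2 ^ (2 - p.toReal)) := by
      rw [show 5 - p.toReal = 3 + (2 - p.toReal) by ring, Real.rpow_add two_pos]
      norm_num
      ring
    rw [h2]
    set W := 2 * 2 ^ (2 - p.toReal) * M * (k₀ ^ p.toReal
      * (beta (1 - γ' / 2) (γ' - 1) * (n : ℝ) ^ (-(γ' - 1)))
      * (‖x‖ ^ (p.toReal / 2) * ‖y‖ ^ (p.toReal / 2))) with hW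
    have hW0 : 0 ≤ W := by positivity
    calc _ = W := by rw [hW]; ring
      _ ≤ 4 * W := by linarith
      _ = _ := by rw [hW, hM_def]; ring
  refine ⟨?_, hXm, ?_, hmix.1, hmix, fun x => ?_, ?_, ?_⟩
  · filter_upwards [hΘ.quasiMeasurePreserving.ae hsum] with ω hω
    rwa [seriesTerm_eq_coordProcess]
  · rw [hμ]
    exact Measure.isProbabilityMeasure_map hXm
  · rw [hμQ]
    exact ⟨_, isDistinguishedLog_functionalLog hchar (norm_levyExponent_sub_le hν₁)
      levyExponent_zero hp_top hk hsum x⟩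
  · intro hγ₂ n hn x y hx hy
    exact hbound γ hγ hγ₂ le_rfl n hn x y hx hy
  · intro hγ₂ ε hε₀ hε₁ n hn x y hx hy
    have h := hbound (2 - ε) (by linarith) (by linarith) (by linarith) n hn x y hx hy
    rwa [show 1 - (2 - ε) / 2 = ε / 2 by ring, show 2 - ε - 1 = 1 - ε by ring] at h
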